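/- For $\phi,\psi\in L^2(\mathbb R)$ and $B\in\mathbb C$ let $A_B=A_B(\phi,\psi)$ be the Friedrichs model operator in $L^2(\mathbb R)$, $$(A_Bf)(x)=xf(x)-c_f+\langle f,\phi\rangle\psi(x),$$ whose domain consists of all $f\in L^2(\mathbb R)$ for which there is a (necessarily unique) $c_f\in\mathbb C$ with $xf(x)-c_f\in L^2(\mathbb R)$, and which satisfy $\Gamma_1f=B\,\Gamma_2f$, where $\Gamma_1f=\lim_{R\to\infty}\int_{-R}^Rf(x)\,dx$ and $\Gamma_2f=c_f$. Let $\widetilde A^*$ be given by the same expression without the condition $\Gamma_1f=B\,\Gamma_2f$. For $\mu_0$ in the resolvent set $\rho(A_B)$ put $\mathcal S_{B,\mu_0}=\mathrm{Span}_{\delta\in\rho(A_B)}(A_B-\delta)^{-1}\mathrm{Ran}(S_{\mu_0,B})$, where the solution operator $S_{\mu_0,B}$ sends a value $w$ to the solution $u$ of $(\widetilde A^*-\mu_0)u=0$, $(\Gamma_1-B\Gamma_2)u=w$. The detectable subspace $\overline{\mathcal S}=\overline{\mathcal S}(\phi,\psi)$ is the closed linear span of all the spaces $\mathcal S_{B,\mu_0}$,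 $B\in\mathbb C$, $\mu_0\in\rho(A_B)$. For $\mu\in\mathbb C\setminus\mathbb R$ put $$\widehat{\overline\phi}(\mu)=\int_{\mathbb R}\frac{\overline{\phi(t)}}{t-\mu}\,dt,\qquad D(\mu)=1+\int_{\mathbb R}\frac{\psi(x)\overline{\phi(x)}}{x-\mu}\,dx,$$ and regard $\widehat{\overline\phi}/D$ as a meromorphic function on $\mathbb C\setminus\mathbb R$. Say that $(\phi,\psi)$ has the continuation property if $\widehat{\overline\phi}/D$ on $\mathbb C_+$ coincides with the meromorphic continuation of $\widehat{\overline\phi}/D$ from $\mathbb C_-$, i.e. if for some nonempty open interval $(a,b)\subset\mathbb R$ there is a meromorphic function on $(\mathbb C\setminus\mathbb R)\cup(a,b)$ that equals $\widehat{\overline\phi}/D$ on $\mathbb C\setminus\mathbb R$. (1) If $\phi$ has compact support, or if $\phi$ vanishes almost everywhere on a nonempty open interval, then $(\phi,\psi)$ has the continuation property. (2) If $(\phi,\psi)$ has the continuation property and $B\in\mathbb C$, then either $\overline{\mathcal S}=L^2(\mathbb R)$, or $\widehat{\overline\phi}/D$ is uniquely determined on $\mathbb C\setminus\mathbb R$ by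 the restricted resolvent $(A_B-\lambda)^{-1}|_{\overline{\mathcal S}}$, $\lambda\in\rho(A_B)\setminus\mathbb R$, up to the choice of the scalar normalisation of $\psi$. That is, in the second case, whenever $\phi',\psi'\in L^2(\mathbb R)$ and $B'\in\mathbb C$ satisfy $\overline{\mathcal S}(\phi',\psi')=\overline{\mathcal S}(\phi,\psi)$, $\rho(A_{B'}(\phi',\psi'))\setminus\mathbb R=\rho(A_B(\phi,\psi))\setminus\mathbb R$ and $$(A_{B'}(\phi',\psi')-\lambda)^{-1}g=(A_B(\phi,\psi)-\lambda)^{-1}g\qquad(g\in\overline{\mathcal S},\ \lambda\in\rho(A_B)\setminus\mathbb R),$$ there is a constant $c\ne0$ with $\psi'=c\,\psi$ and, with $D'$ the function $D$ of $(\phi',\psi')$, $$\frac{\widehat{\overline\phi}(\mu)}{D(\mu)}=c\,\frac{\widehat{\overline{\phi'}}(\mu)}{D'(\mu)}\qquad\text{for all }\mu\in\mathbb C\setminus\mathbb R\text{ with }D(\mu)\neq0\neq D'(\mu).$$ In particular $\widehat{\overline\phi}/D=\widehat{\overline{\phi'}}/D'$ if $\psi'=\psi$. -/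

import Mathlib

open MeasureTheory Filter Topology

/-- The Hilbert space `L²(ℝ)` of complex valued functions. -/
abbrev L2R : Type := Lp ℂ 2 (volume : Measure ℝ)

section Traces

/-- The constant `c_f` is uniquely determined, since nonzero constants are not in `L²(ℝ)`. -/
theorem traceConst_unique (f : ℝ → ℂ) (c d : ℂ)
    (hc : MemLp (fun x : ℝ => (x : ℂ) * f x - c) 2 volume)
    (hd : MemLp (fun x : ℝ => (x : ℂ) * f x - d) 2 volume) : c = d := by
  have h := hd.sub hc
  have e : ((fun x : ℝ => (x : ℂ) * f x - d) - fun x : ℝ => (x : ℂ) * f x - c)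
      = fun _ : ℝ => c - d := by
    funext x; simp
  rw [e, memLp_const_iff (by norm_num) (by norm_num)] at h
  rcases h with h | h
  · exact sub_eq_zero.mp h
  · simp at h

/-- `Dom(Ã*) = Dom(A*)`: all `f ∈ L²(ℝ)` such that `x f(x) - c_f ∈ L²(ℝ)` for some constant
`c_f`. -/
def maxDomain : Submodule ℂ L2R where
  carrier := {f | ∃ c : ℂ, MemLp (fun x : ℝ => (x : ℂ) * f x - c) 2 volume}
  zero_mem' := by
    refine ⟨0, ?_⟩
    refine (MemLp.zero (ε := ℂ) (p := 2) (μ := (volume : Measure ℝ))).ae_eq ?_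
    filter_upwards [Lp.coeFn_zero ℂ 2 (volume : Measure ℝ)] with x hx
    simp
  add_mem' := by
    rintro f g ⟨c, hc⟩ ⟨d, hd⟩
    refine ⟨c + d, (hc.add hd).ae_eq ?_⟩
    filter_upwards [Lp.coeFn_add f g] with x hx
    simp only [hx, Pi.add_apply]
    ring
  smul_mem' := by
    rintro a f ⟨c, hc⟩
    refine ⟨a * c, (hc.const_smul a).ae_eq ?_⟩
    filter_upwards [Lp.coeFn_smul a f] with x hx
    simp only [hx, Pi.smul_apply, smul_eq_mul]
    ring

/-- The constant `c_f` of an element of the maximal domain. -/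
noncomputable def traceConst (f : maxDomain) : ℂ := Classical.choose f.2

theorem traceConst_spec (f : maxDomain) :
    MemLp (fun x : ℝ => (x : ℂ) * (f : L2R) x - traceConst f) 2 volume :=
  Classical.choose_spec f.2

theorem traceConst_add (f g : maxDomain) :
    traceConst (f + g) = traceConst f + traceConst g := by
  refine traceConst_unique _ _ _ (traceConst_spec (f + g)) ?_
  refine ((traceConst_spec f).add (traceConst_spec g)).ae_eq ?_
  filter_upwards [Lp.coeFn_add (f : L2R) (g : L2R)] with x hx
  simp only [Submodule.coe_add, hx, Pi.add_apply]
  ring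

theorem traceConst_smul (a : ℂ) (f : maxDomain) :
    traceConst (a • f) = a * traceConst f := by
  refine traceConst_unique _ _ _ (traceConst_spec (a • f)) ?_
  refine ((traceConst_spec f).const_smul a).ae_eq ?_
  filter_upwards [Lp.coeFn_smul a (f : L2R)] with x hx
  simp only [Submodule.coe_smul, hx, Pi.smul_apply, smul_eq_mul]
  ring

/-- The trace `Γ₂ u = c_u`. -/
noncomputable def Gamma2 : maxDomain →ₗ[ℂ] ℂ where
  toFun := traceConst
  map_add' := traceConst_add
  map_smul' a f := by simp [traceConst_smul]

/-- On the maximal domain the limit `lim_{R → ∞} ∫_{-R}^R u(x) dx` exists. -/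
theorem exists_tendsto_integral (f : maxDomain) :
    ∃ l : ℂ, Tendsto (fun R : ℝ => ∫ x in (-R)..R, (f : L2R) x) atTop (𝓝 l) := by
  set c := traceConst f
  have hk := traceConst_spec f
  have hpos : ∀ x : ℝ, (0 : ℝ) < 1 + x ^ 2 := fun x => by positivity
  have hw : MemLp (fun x : ℝ => (((1 + x ^ 2)⁻¹ : ℝ) : ℂ)) 2 volume := by
    rw [memLp_two_iff_integrable_sq_norm (by fun_prop)]
    refine integrable_inv_one_add_sq.mono (by fun_prop) (ae_of_all _ fun x => ?_)
    have h1 : (1 + x ^ 2)⁻¹ ≤ 1 := inv_le_one_of_one_le₀ (by nlinarith [sq_nonneg x])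
    have h0 : 0 ≤ (1 + x ^ 2)⁻¹ := (inv_pos.mpr (hpos x)).le
    simp only [Complex.norm_real, Real.norm_eq_abs, abs_of_nonneg h0,
      abs_of_nonneg (sq_nonneg ((1 + x ^ 2)⁻¹))]
    nlinarith
  have hv : MemLp (fun x : ℝ => ((x * (1 + x ^ 2)⁻¹ : ℝ) : ℂ)) 2 volume := by
    rw [memLp_two_iff_integrable_sq_norm (by fun_prop)]
    refine integrable_inv_one_add_sq.mono (by fun_prop) (ae_of_all _ fun x => ?_)
    have h0 : 0 ≤ (1 + x ^ 2)⁻¹ := (inv_pos.mpr (hpos x)).le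
    have h1 : (1 + x ^ 2) * (1 + x ^ 2)⁻¹ = 1 := mul_inv_cancel₀ (hpos x).ne'
    simp only [Complex.norm_real, Real.norm_eq_abs, sq_abs, abs_of_nonneg h0,
      abs_of_nonneg (sq_nonneg (x * (1 + x ^ 2)⁻¹))]
    nlinarith [mul_nonneg h0 h0]
  have hint : Integrable (fun x : ℝ => (f : L2R) x - c * ((x * (1 + x ^ 2)⁻¹ : ℝ) : ℂ)) := by
    have h := (hv.integrable_mul hk).add (hw.integrable_mul (Lp.memLp (f : L2R)))
    refine h.congr (ae_of_all _ fun x => ?_)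
    have h1 : (1 + (x : ℂ) ^ 2) ≠ 0 := by exact_mod_cast (hpos x).ne'
    simp only [Pi.add_apply, Pi.mul_apply]
    push_cast
    field_simp
    ring
  refine ⟨_, (intervalIntegral_tendsto_integral hint tendsto_neg_atTop_atBot
    tendsto_id).congr fun R => ?_⟩
  have hcont : Continuous fun x : ℝ => c * ((x * (1 + x ^ 2)⁻¹ : ℝ) : ℂ) := by
    have : Continuous fun x : ℝ => (1 + x ^ 2)⁻¹ :=
      Continuous.inv₀ (by fun_prop) fun x => (hpos x).ne'
    fun_prop
  have hodd : ∫ x in (-R)..R, c * ((x * (1 + x ^ 2)⁻¹ : ℝ) : ℂ) = 0 := by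
    have h := intervalIntegral.integral_comp_neg (a := -R) (b := R)
      (fun x : ℝ => c * ((x * (1 + x ^ 2)⁻¹ : ℝ) : ℂ))
    simp only [neg_neg, neg_mul, neg_sq, Complex.ofReal_neg, mul_neg,
      intervalIntegral.integral_neg] at h
    exact self_eq_neg.mp h.symm
  have hf : IntervalIntegrable (fun x : ℝ => (f : L2R) x) volume (-R) R := by
    have := hint.intervalIntegrable (a := -R) (b := R)
    simpa using this.add (hcont.intervalIntegrable (-R) R)
  change ∫ x in (-R)..R, ((f : L2R) x - c * ((x * (1 + x ^ 2)⁻¹ : ℝ) : ℂ)) = _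
  rw [intervalIntegral.integral_sub hf (hcont.intervalIntegrable _ _), hodd, sub_zero]

/-- The value `lim_{R → ∞} ∫_{-R}^R u(x) dx`. -/
noncomputable def traceInt (f : maxDomain) : ℂ := Classical.choose (exists_tendsto_integral f)

theorem traceInt_spec (f : maxDomain) :
    Tendsto (fun R : ℝ => ∫ x in (-R)..R, (f : L2R) x) atTop (𝓝 (traceInt f)) :=
  Classical.choose_spec (exists_tendsto_integral f)

theorem intervalIntegrable_L2R (f : L2R) (a b : ℝ) :
    IntervalIntegrable (fun x : ℝ => f x) volume a b := by
  refine (LocallyIntegrable.integrableOn_isCompact ?_ isCompact_uIcc).intervalIntegrable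
  exact (Lp.memLp f).locallyIntegrable (by norm_num)

/-- The trace `Γ₁ u = lim_{R → ∞} ∫_{-R}^R u(x) dx`. -/
noncomputable def Gamma1 : maxDomain →ₗ[ℂ] ℂ where
  toFun := traceInt
  map_add' f g := by
    refine tendsto_nhds_unique (traceInt_spec (f + g))
      (((traceInt_spec f).add (traceInt_spec g)).congr fun R => ?_)
    rw [← intervalIntegral.integral_add (intervalIntegrable_L2R _ _ _)
      (intervalIntegrable_L2R _ _ _)]
    refine intervalIntegral.integral_congr_ae ?_
    filter_upwards [Lp.coeFn_add (f : L2R) (g : L2R)] with x hx _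
    rw [Submodule.coe_add, hx, Pi.add_apply]
  map_smul' a f := by
    refine tendsto_nhds_unique (traceInt_spec (a • f))
      (((traceInt_spec f).const_mul a).congr fun R => ?_)
    rw [← intervalIntegral.integral_const_mul]
    refine intervalIntegral.integral_congr_ae ?_
    filter_upwards [Lp.coeFn_smul a (f : L2R)] with x hx _
    rw [Submodule.coe_smul, hx, Pi.smul_apply, smul_eq_mul]

end Traces

section Operators

/-- The operator `Ã*` of the Friedrichs model, on `maxDomain`:
`(Ã* f)(x) = x f(x) - c_f + ⟨f, φ⟩ ψ(x)`, where `⟨f, φ⟩ = ∫ f(x) conj(φ(x)) dx`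
(Mathlib's `inner` is conjugate linear in its first argument). -/
noncomputable def friedrichsMax (φ ψ : L2R) : L2R →ₗ.[ℂ] L2R where
  domain := maxDomain
  toFun :=
    { toFun := fun f => (traceConst_spec f).toLp _ + inner ℂ φ (f : L2R) • ψ
      map_add' := by
        intro f g
        have h : (traceConst_spec (f + g)).toLp _
            = (traceConst_spec f).toLp _ + (traceConst_spec g).toLp _ := by
          rw [← MemLp.toLp_add]
          refine MemLp.toLp_congr _ _ ?_
          filter_upwards [Lp.coeFn_add (f : L2R) (g : L2R)] with x hx
          simp only [Submodule.coe_add, hx, Pi.add_apply, traceConst_add]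
          ring
        rw [h, Submodule.coe_add, inner_add_right, add_smul]
        abel
      map_smul' := by
        intro a f
        have h : (traceConst_spec (a • f)).toLp _ = a • (traceConst_spec f).toLp _ := by
          rw [← MemLp.toLp_const_smul]
          refine MemLp.toLp_congr _ _ ?_
          filter_upwards [Lp.coeFn_smul a (f : L2R)] with x hx
          simp only [Submodule.coe_smul, hx, Pi.smul_apply, smul_eq_mul, traceConst_smul]
          ring
        rw [h, Submodule.coe_smul, inner_smul_right, mul_smul, ← smul_add]
        rfl }

/-- The operator `A_B`, the restriction of `Ã*` to `ker (Γ₁ - B Γ₂)`. -/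
noncomputable def friedrichsExt (φ ψ : L2R) (B : ℂ) : L2R →ₗ.[ℂ] L2R :=
  (friedrichsMax φ ψ).domRestrict
    ((LinearMap.ker (Gamma1 - B • Gamma2)).map maxDomain.subtype)

/-- `R` is the bounded, everywhere defined inverse of `T - z`. -/
def IsResolventOf (T : L2R →ₗ.[ℂ] L2R) (z : ℂ) (R : L2R →L[ℂ] L2R) : Prop :=
  ∀ f g : L2R, R g = f ↔ ∃ hf : f ∈ T.domain, T ⟨f, hf⟩ - z • f = g

/-- The resolvent set `ρ(T)` of an operator `T` in `L²(ℝ)`. -/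
def resolventSetOf (T : L2R →ₗ.[ℂ] L2R) : Set ℂ :=
  {z | ∃ R : L2R →L[ℂ] L2R, IsResolventOf T z R}

open Classical in
/-- The resolvent `(T - z)⁻¹` for `z ∈ ρ(T)` (and `0` for all other `z`). -/
noncomputable def resolventOf (T : L2R →ₗ.[ℂ] L2R) (z : ℂ) : L2R →L[ℂ] L2R :=
  if h : ∃ R : L2R →L[ℂ] L2R, IsResolventOf T z R then Classical.choose h else 0

/-- The range of the solution operator `S_{z,B}`, which sends a boundary value `w` to the `u`
with `(Ã* - z) u = 0` and `(Γ₁ - B Γ₂) u = w`. -/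
def solutionRange (φ ψ : L2R) (B z : ℂ) : Set L2R :=
  {u | ∃ w : ℂ, ∃ hu : u ∈ maxDomain,
    friedrichsMax φ ψ ⟨u, hu⟩ - z • u = 0 ∧ Gamma1 ⟨u, hu⟩ - B * Gamma2 ⟨u, hu⟩ = w}

/-- `S_B`, the linear span of `(A_B - δ)⁻¹ Ran(S_{μ₀,B})` over all `δ ∉ σ(A_B)`. -/
noncomputable def detectableSpan (φ ψ : L2R) (B μ₀ : ℂ) : Submodule ℂ L2R :=
  Submodule.span ℂ {v | ∃ δ ∈ resolventSetOf (friedrichsExt φ ψ B),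
    ∃ u ∈ solutionRange φ ψ B μ₀, v = resolventOf (friedrichsExt φ ψ B) δ u}

/-- The detectable subspace: the smallest closed subspace of `L²(ℝ)` containing `S_B` for every
boundary parameter `B` and every admissible base point `μ₀ ∈ ρ(A_B)`. -/
noncomputable def detectableSubspace (φ ψ : L2R) : Submodule ℂ L2R :=
  (⨆ (B : ℂ) (μ₀ : ℂ) (_ : μ₀ ∈ resolventSetOf (friedrichsExt φ ψ B)),
    detectableSpan φ ψ B μ₀).topologicalClosure

/-- The models `(φ₁, ψ₁, B₁)` and `(φ₂, ψ₂, B₂)` have the same restricted resolvents: the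
detectable subspaces agree, the non-real points of the resolvent sets agree, and at each of these
points the two resolvents agree on the detectable subspace. -/
def SameRestrictedResolvent (φ₁ ψ₁ : L2R) (B₁ : ℂ) (φ₂ ψ₂ : L2R) (B₂ : ℂ) : Prop :=
  detectableSubspace φ₁ ψ₁ = detectableSubspace φ₂ ψ₂ ∧
  ∀ z : ℂ, z.im ≠ 0 →
    (z ∈ resolventSetOf (friedrichsExt φ₁ ψ₁ B₁) ↔
      z ∈ resolventSetOf (friedrichsExt φ₂ ψ₂ B₂)) ∧
    (z ∈ resolventSetOf (friedrichsExt φ₁ ψ₁ B₁) → ∀ g ∈ detectableSubspace φ₁ ψ₁,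
      resolventOf (friedrichsExt φ₁ ψ₁ B₁) z g = resolventOf (friedrichsExt φ₂ ψ₂ B₂) z g)

end Operators

section Transforms

/-- The Cauchy transform of `conj φ`: the integral of `conj (φ t) / (t - z)`. -/
noncomputable def cauchyConj (φ : L2R) (z : ℂ) : ℂ :=
  ∫ t : ℝ, (starRingEnd ℂ) (φ t) / ((t : ℂ) - z)

/-- `D(z) = 1 + ∫ ψ(x) conj(φ(x)) / (x - z) dx`. -/
noncomputable def perturbD (φ ψ : L2R) (z : ℂ) : ℂ :=
  1 + ∫ x : ℝ, ψ x * (starRingEnd ℂ) (φ x) / ((x : ℂ) - z)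

/-- The quotient of the Cauchy transform of `conj φ` by `D` on the upper half-plane is the
(meromorphic) continuation of the same quotient on the lower half-plane: some function meromorphic
on the connected open set `(ℂ ∖ ℝ) ∪ (a, b)`, for some interval `(a, b)` of the real line, equals
the quotient at all non-real points that are not zeros of `D`. -/
def QuotientContinues (φ ψ : L2R) : Prop :=
  ∃ a b : ℝ, a < b ∧ ∃ F : ℂ → ℂ,
    MeromorphicOn F {z : ℂ | z.im ≠ 0 ∨ z.re ∈ Set.Ioo a b} ∧
    ∀ z : ℂ, z.im ≠ 0 → perturbD φ ψ z ≠ 0 → F z = cauchyConj φ z / perturbD φ ψ z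

end Transforms

/-! Write M for the quotient of the Cauchy transform of conj φ by D, and u_μ = (1 - M(μ)ψ)/(t - μ)
(`defectSol`). When D(μ) ≠ 0 this solves (Ã* - μ)u = 0, has Γ₂ u_μ = 1 and, decisively, ⟨u_μ, φ⟩ =
M(μ). As z tends to infinity along a suitable half of the imaginary axis, (z - μ)(A_B - z)⁻¹u_μ →
-u_μ, so u_μ is detectable (`defectSol_mem_detectableSubspace`).

If two models have the same restricted resolvents, then v = (A_B - z)⁻¹u_μ solves both resolvent
equations. Their unperturbed parts coincide, hence ⟨v, φ⟩ψ = ⟨v, φ'⟩ψ'; multiplying by z - μ and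
letting z → ∞ gives M(μ)ψ = ⟨u_μ, φ'⟩ψ' (`inner_smul_eq_of_sameRestrictedResolvent`). If M(μ)ψ ≠ 0
for some μ, then ψ' = cψ, and the relation at the other points is a linear equation for M(μ) whose
solution is c times the primed quotient (`cauchyConj_smul_div`).

If M(μ)ψ = 0 for all μ, then u_μ is the Cauchy kernel itself; these kernels span a dense subspace,
because a Cauchy transform determines its density, so the detectable subspace is everything
(`detectableSubspace_eq_top`).

The continuation statements hold because Cauchy integrals are analytic off the support of their
density. -/

/-! ### Cauchy integrals: bounds and analyticity -/

theorem norm_ofReal_sub_I_le {z : ℂ} {ε t : ℝ} (hε : 0 < ε) (h : ε ≤ ‖(t : ℂ) - z‖) :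
    ‖(t : ℂ) - Complex.I‖ ≤ (1 + ‖z - Complex.I‖ / ε) * ‖(t : ℂ) - z‖ := by
  have h1 : ‖(t : ℂ) - Complex.I‖ ≤ ‖(t : ℂ) - z‖ + ‖z - Complex.I‖ := by
    simpa using norm_add_le ((t : ℂ) - z) (z - Complex.I)
  have h2 : ‖z - Complex.I‖ ≤ ‖z - Complex.I‖ / ε * ‖(t : ℂ) - z‖ := by
    rw [div_mul_eq_mul_div, le_div_iff₀ hε]
    gcongr
  linarith

theorem ofReal_sub_ne_zero {z : ℂ} (hz : z.im ≠ 0) (t : ℝ) : (t : ℂ) - z ≠ 0 := by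
  intro h
  apply hz
  simpa using congrArg Complex.im h

theorem abs_im_le_norm_ofReal_sub (z : ℂ) (t : ℝ) : |z.im| ≤ ‖(t : ℂ) - z‖ := by
  simpa using Complex.abs_im_le_norm ((t : ℂ) - z)

/-- Compares every Cauchy kernel with the one at i, so that integrability against that single kernel
controls all the others. -/
theorem norm_inv_ofReal_sub_le {z : ℂ} {ε t : ℝ} (hε : 0 < ε) (h : ε ≤ ‖(t : ℂ) - z‖) :
    ‖((t : ℂ) - z)⁻¹‖ ≤ (1 + ‖z - Complex.I‖ / ε) * ‖((t : ℂ) - Complex.I)⁻¹‖ := by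
  have h1 := norm_ofReal_sub_I_le hε h
  have h2 : 0 < ‖(t : ℂ) - z‖ := hε.trans_le h
  have h3 : 0 < ‖(t : ℂ) - Complex.I‖ :=
    norm_pos_iff.mpr (ofReal_sub_ne_zero (by simp) t)
  rw [norm_inv, norm_inv, ← div_eq_mul_inv, inv_eq_one_div, div_le_div_iff₀ h2 h3]
  linarith

theorem memLp_inv_ofReal_sub {z : ℂ} (hz : z.im ≠ 0) :
    MemLp (fun t : ℝ => ((t : ℂ) - z)⁻¹) 2 volume := by
  have hI : MemLp (fun t : ℝ => ((t : ℂ) - Complex.I)⁻¹) 2 volume := by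
    rw [memLp_two_iff_integrable_sq_norm (by fun_prop)]
    refine integrable_inv_one_add_sq.congr (ae_of_all _ fun t => ?_)
    simp only [norm_inv, inv_pow]
    rw [Complex.sq_norm, Complex.normSq_apply]
    simp
    ring
  refine (hI.const_mul ((1 + ‖z - Complex.I‖ / |z.im| : ℝ) : ℂ)).mono (by fun_prop)
    (ae_of_all _ fun t => ?_)
  refine (norm_inv_ofReal_sub_le (abs_pos.mpr hz) (abs_im_le_norm_ofReal_sub z t)).trans ?_
  rw [norm_mul, Complex.norm_real, Real.norm_of_nonneg (by positivity)]

theorem aestronglyMeasurable_div_sub_pow {h : ℝ → ℂ} (hm : AEStronglyMeasurable h volume)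
    (z : ℂ) (n : ℕ) :
    AEStronglyMeasurable (fun t : ℝ => h t / ((t : ℂ) - z) ^ n) volume := by
  simp only [div_eq_mul_inv]
  exact hm.mul (by fun_prop)

theorem aestronglyMeasurable_div_sub {h : ℝ → ℂ} (hm : AEStronglyMeasurable h volume) (z : ℂ) :
    AEStronglyMeasurable (fun t : ℝ => h t / ((t : ℂ) - z)) volume := by
  simpa using aestronglyMeasurable_div_sub_pow hm z 1

/-- The Cauchy transform `z ↦ ∫ h t / (t - z)` is analytic off the support of `h`. -/
theorem analyticOnNhd_integral_div_sub {h : ℝ → ℂ} {U : Set ℂ} (hU : IsOpen U)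
    (hi : Integrable (fun t : ℝ => h t / ((t : ℂ) - Complex.I)))
    (h0 : ∀ᵐ t : ℝ, (t : ℂ) ∈ U → h t = 0) :
    AnalyticOnNhd ℂ (fun z => ∫ t : ℝ, h t / ((t : ℂ) - z)) U := by
  have hm : AEStronglyMeasurable h := by
    have : AEStronglyMeasurable (fun t : ℝ => h t / ((t : ℂ) - Complex.I) * ((t : ℂ) - Complex.I))
        volume := hi.1.mul (by fun_prop)
    refine this.congr (ae_of_all _ fun t => ?_)
    exact div_mul_cancel₀ _ (ofReal_sub_ne_zero (by simp) t)
  refine DifferentiableOn.analyticOnNhd (fun z hz => ?_) hU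
  obtain ⟨r, hr, hb⟩ := Metric.isOpen_iff.mp hU z hz
  have hfar : ∀ᵐ t : ℝ, h t = 0 ∨ r ≤ ‖(t : ℂ) - z‖ := by
    filter_upwards [h0] with t ht
    by_cases htU : (t : ℂ) ∈ U
    · exact Or.inl (ht htU)
    · refine Or.inr ?_
      by_contra! hlt
      exact htU (hb (by simpa [dist_eq_norm] using hlt))
  have hint : Integrable (fun t : ℝ => h t / ((t : ℂ) - z)) := by
    refine (hi.const_mul ((1 + ‖z - Complex.I‖ / r : ℝ) : ℂ)).mono
      (aestronglyMeasurable_div_sub hm z) ?_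
    filter_upwards [hfar] with t ht
    rcases ht with ht | ht
    · simp [ht]
    · rw [div_eq_mul_inv (h t), div_eq_mul_inv (h t), norm_mul, norm_mul, norm_mul,
        Complex.norm_real, Real.norm_of_nonneg (by positivity)]
      have := mul_le_mul_of_nonneg_left (norm_inv_ofReal_sub_le hr ht) (norm_nonneg (h t))
      linarith
  -- For |w - z| < r/2 and |t - z| ≥ r one has |t - z| ≤ 2|t - w|, hence 1/|t - w|² ≤ 4/|t - z|² ≤
  -- (4/r)/|t - z|.
  have key := hasDerivAt_integral_of_dominated_loc_of_deriv_le (μ := volume) (𝕜 := ℂ)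
    (F := fun w t => h t / ((t : ℂ) - w)) (F' := fun w t => h t / ((t : ℂ) - w) ^ 2)
    (x₀ := z) (s := Metric.ball z (r / 2)) (bound := fun t => 4 / r * ‖h t / ((t : ℂ) - z)‖)
    (Metric.ball_mem_nhds z (by positivity))
    (Eventually.of_forall fun w => aestronglyMeasurable_div_sub hm w) hint
    (aestronglyMeasurable_div_sub_pow hm z 2) ?_ (hint.norm.const_mul _) ?_
  · exact key.2.differentiableAt.differentiableWithinAt
  · filter_upwards [hfar] with t ht w hw
    rcases ht with ht | ht
    · simp [ht]
    · have hw' : ‖w - z‖ < r / 2 := by simpa [dist_eq_norm] using hw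
      have h1 : ‖(t : ℂ) - z‖ ≤ ‖(t : ℂ) - w‖ + ‖w - z‖ := by
        simpa using norm_add_le ((t : ℂ) - w) (w - z)
      have h2 : ‖(t : ℂ) - z‖ ≤ 2 * ‖(t : ℂ) - w‖ := by linarith
      have h3 : 0 < ‖(t : ℂ) - z‖ := hr.trans_le ht
      have h4 : 0 < ‖(t : ℂ) - w‖ := by linarith
      rw [norm_div, norm_div, norm_pow, div_mul_div_comm, div_le_div_iff₀ (by positivity)
        (by positivity)]
      have h5 : r * ‖(t : ℂ) - z‖ ≤ 4 * ‖(t : ℂ) - w‖ ^ 2 := by nlinarith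
      nlinarith [norm_nonneg (h t)]
  · filter_upwards [hfar] with t ht w hw
    rcases ht with ht | ht
    · simpa [ht] using hasDerivAt_const w (0 : ℂ)
    · have hw' : ‖w - z‖ < r / 2 := by simpa [dist_eq_norm] using hw
      have h1 : ‖(t : ℂ) - z‖ ≤ ‖(t : ℂ) - w‖ + ‖w - z‖ := by
        simpa using norm_add_le ((t : ℂ) - w) (w - z)
      have h4 : (t : ℂ) - w ≠ 0 := norm_pos_iff.mp (by linarith)
      have := (hasDerivAt_const w (h t)).div ((hasDerivAt_id w).const_sub (t : ℂ)) h4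
      simpa [Pi.div_def] using this

theorem integrable_conj_div_sub_I (φ : L2R) :
    Integrable (fun t : ℝ => (starRingEnd ℂ) (φ t) / ((t : ℂ) - Complex.I)) := by
  have := (Lp.memLp φ).star.integrable_mul (memLp_inv_ofReal_sub (z := Complex.I) (by simp))
  simpa only [div_eq_mul_inv, Pi.mul_def, Pi.star_apply, RCLike.star_def] using this

theorem integrable_mul_conj (φ ψ : L2R) :
    Integrable (fun t : ℝ => ψ t * (starRingEnd ℂ) (φ t)) :=
  (Lp.memLp ψ).integrable_mul (Lp.memLp φ).star

theorem integrable_mul_conj_div_sub_I (φ ψ : L2R) :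
    Integrable (fun t : ℝ => ψ t * (starRingEnd ℂ) (φ t) / ((t : ℂ) - Complex.I)) := by
  refine (integrable_mul_conj φ ψ).mono
    (aestronglyMeasurable_div_sub (integrable_mul_conj φ ψ).1 _) (ae_of_all _ fun t => ?_)
  rw [norm_div]
  refine div_le_self (norm_nonneg _) ?_
  simpa using abs_im_le_norm_ofReal_sub Complex.I t

/-! ### Sufficient conditions for the continuation property -/

theorem isOpen_nonreal_or_Ioo (a b : ℝ) :
    IsOpen {z : ℂ | z.im ≠ 0 ∨ z.re ∈ Set.Ioo a b} :=
  (isOpen_ne_fun Complex.continuous_im continuous_const).union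
    (isOpen_Ioo.preimage Complex.continuous_re)

theorem quotientContinues_of_ae_eq_zero_Ioo {φ : L2R} (ψ : L2R) {a b : ℝ} (hab : a < b)
    (h : ∀ᵐ x : ℝ, x ∈ Set.Ioo a b → φ x = 0) : QuotientContinues φ ψ := by
  refine ⟨a, b, hab, fun z => cauchyConj φ z / perturbD φ ψ z, ?_, fun z _ _ => rfl⟩
  have h1 : AnalyticOnNhd ℂ (cauchyConj φ) {z : ℂ | z.im ≠ 0 ∨ z.re ∈ Set.Ioo a b} := by
    refine analyticOnNhd_integral_div_sub (isOpen_nonreal_or_Ioo a b)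
      (integrable_conj_div_sub_I φ) ?_
    filter_upwards [h] with t ht htU
    simp [ht (by simpa using htU)]
  have h2 : AnalyticOnNhd ℂ (perturbD φ ψ) {z : ℂ | z.im ≠ 0 ∨ z.re ∈ Set.Ioo a b} := by
    refine analyticOnNhd_const.add (analyticOnNhd_integral_div_sub (isOpen_nonreal_or_Ioo a b)
      (integrable_mul_conj_div_sub_I φ ψ) ?_)
    filter_upwards [h] with t ht htU
    simp [ht (by simpa using htU)]
  exact fun z hz => (h1 z hz).meromorphicAt.div (h2 z hz).meromorphicAt

theorem quotientContinues_of_isCompact {φ : L2R} (ψ : L2R) {K : Set ℝ} (hK : IsCompact K)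
    (h : ∀ᵐ x : ℝ, x ∉ K → φ x = 0) : QuotientContinues φ ψ := by
  obtain ⟨M, hM⟩ := hK.bddAbove
  -- Since M is an upper bound of K, φ vanishes on the gap (M, M + 1).
  refine quotientContinues_of_ae_eq_zero_Ioo ψ (lt_add_one M) ?_
  filter_upwards [h] with x hx hxM
  exact hx fun hxK => (hM hxK).not_gt hxM.1

/-! ### Uniqueness for Cauchy transforms, via Poisson kernels -/

theorem integrable_mul_inv_one_add_sq {g : ℝ → ℂ} (hg : MemLp g 2 volume) :
    Integrable (fun t : ℝ => ‖g t‖ * (1 + t ^ 2)⁻¹) := by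
  have h1 : MemLp (fun t : ℝ => (1 + t ^ 2)⁻¹) 2 volume := by
    rw [memLp_two_iff_integrable_sq (by fun_prop)]
    refine integrable_inv_one_add_sq.mono (by fun_prop) (ae_of_all _ fun t => ?_)
    have h0 : (0 : ℝ) < 1 + t ^ 2 := by positivity
    have h2 : (1 + t ^ 2)⁻¹ ≤ 1 := inv_le_one_of_one_le₀ (by nlinarith [sq_nonneg t])
    rw [Real.norm_of_nonneg (by positivity), Real.norm_of_nonneg (by positivity)]
    nlinarith [inv_pos.mpr h0]
  exact hg.norm.integrable_mul h1

/-- The Poisson kernel of height `y`, integrated over `x ∈ [a, b]`. -/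
theorem integral_poisson_eq_arctan (a b y t : ℝ) :
    ∫ x in a..b, y / (y ^ 2 + (x - t) ^ 2)
      = Real.arctan ((b - t) / y) - Real.arctan ((a - t) / y) := by
  rw [intervalIntegral.integral_comp_sub_right (fun x => y / (y ^ 2 + x ^ 2)) t,
    integral_div_sq_add_sq]

/-- A majorant uniform in y ∈ (0, 1], for dominated convergence. For small |t| the difference of
arctangents is at most π. For large |t| it is the integral of the Poisson kernel, which is at most
4/t² ≤ 8/(1 + t²) on [a, b]. -/
theorem abs_arctan_sub_arctan_le {a b y t : ℝ} (hab : a ≤ b) (hy : 0 < y) (hy1 : y ≤ 1) :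
    |Real.arctan ((b - t) / y) - Real.arctan ((a - t) / y)|
      ≤ (Real.pi * (1 + (2 * (|a| + |b| + 1)) ^ 2) + 8 * (b - a)) * (1 + t ^ 2)⁻¹ := by
  have h1t : (0 : ℝ) < 1 + t ^ 2 := by positivity
  have hba : 0 ≤ b - a := sub_nonneg.mpr hab
  rw [← div_eq_mul_inv, le_div_iff₀ h1t]
  by_cases ht : |t| ≤ 2 * (|a| + |b| + 1)
  · have h1 : |Real.arctan ((b - t) / y) - Real.arctan ((a - t) / y)| ≤ Real.pi := by
      rw [abs_le]
      constructor <;>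
      linarith [Real.arctan_lt_pi_div_two ((b - t) / y), Real.neg_pi_div_two_lt_arctan ((b - t) / y),
        Real.arctan_lt_pi_div_two ((a - t) / y), Real.neg_pi_div_two_lt_arctan ((a - t) / y)]
    have h2 : t ^ 2 ≤ (2 * (|a| + |b| + 1)) ^ 2 := by
      rw [← sq_abs t]
      gcongr
    calc _ ≤ Real.pi * (1 + (2 * (|a| + |b| + 1)) ^ 2) := by gcongr
      _ ≤ _ := by linarith
  · push Not at ht
    have hpt : ∀ x ∈ Set.uIoc a b, ‖y / (y ^ 2 + (x - t) ^ 2)‖ ≤ 8 / (1 + t ^ 2) := by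
      intro x hx
      rw [Set.uIoc_of_le hab] at hx
      have hx1 : |x| ≤ |a| + |b| := by
        rw [abs_le]
        constructor
        · linarith [neg_abs_le a, abs_nonneg b, hx.1]
        · linarith [le_abs_self b, abs_nonneg a, hx.2]
      have h3 : |t| / 2 ≤ |x - t| := by
        have := abs_sub_abs_le_abs_sub t x
        rw [abs_sub_comm] at this
        linarith
      have h4 : t ^ 2 / 4 ≤ (x - t) ^ 2 := by
        rw [← sq_abs t, ← sq_abs (x - t)]
        nlinarith [abs_nonneg t]
      have h5 : 1 ≤ t ^ 2 := by
        rw [← sq_abs t]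
        nlinarith [abs_nonneg a, abs_nonneg b]
      rw [Real.norm_of_nonneg (by positivity), div_le_div_iff₀ (by positivity) h1t]
      nlinarith
    have h := intervalIntegral.norm_integral_le_of_norm_le_const hpt
    rw [integral_poisson_eq_arctan, Real.norm_eq_abs, abs_of_nonneg hba] at h
    have h6 : 8 / (1 + t ^ 2) * (b - a) * (1 + t ^ 2) = 8 * (b - a) := by
      field_simp
    have h7 := mul_le_mul_of_nonneg_right h h1t.le
    rw [h6] at h7
    have : 0 ≤ Real.pi * (1 + (2 * (|a| + |b| + 1)) ^ 2) := by positivity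
    linarith

theorem tendsto_arctan_div_nhdsGT {s : ℝ} (hs : 0 < s) :
    Tendsto (fun y : ℝ => Real.arctan (s / y)) (𝓝[>] 0) (𝓝 (Real.pi / 2)) := by
  refine (tendsto_nhds_of_tendsto_nhdsWithin Real.tendsto_arctan_atTop).comp ?_
  exact (tendsto_inv_nhdsGT_zero.const_mul_atTop hs).congr fun y => (div_eq_mul_inv s y).symm

theorem tendsto_arctan_div_nhdsGT_of_neg {s : ℝ} (hs : s < 0) :
    Tendsto (fun y : ℝ => Real.arctan (s / y)) (𝓝[>] 0) (𝓝 (-(Real.pi / 2))) := by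
  have := (tendsto_arctan_div_nhdsGT (neg_pos.mpr hs)).neg
  simpa [neg_div, Real.arctan_neg] using this

theorem tendsto_arctan_sub_arctan {a b t : ℝ} (hab : a < b) (ha : t ≠ a) (hb : t ≠ b) :
    Tendsto (fun y : ℝ => Real.arctan ((b - t) / y) - Real.arctan ((a - t) / y)) (𝓝[>] 0)
      (𝓝 ((Set.Ioc a b).indicator (fun _ => Real.pi) t)) := by
  rcases lt_or_gt_of_ne ha with h1 | h1
  · have := (tendsto_arctan_div_nhdsGT (s := b - t) (by linarith)).sub
      (tendsto_arctan_div_nhdsGT (s := a - t) (by linarith))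
    rw [Set.indicator_of_notMem (fun h => absurd h.1 (by linarith))]
    simpa using this
  · rcases lt_or_gt_of_ne hb with h2 | h2
    · have := (tendsto_arctan_div_nhdsGT (s := b - t) (by linarith)).sub
        (tendsto_arctan_div_nhdsGT_of_neg (s := a - t) (by linarith))
      rw [Set.indicator_of_mem (show t ∈ Set.Ioc a b from ⟨h1, h2.le⟩)]
      simpa using this
    · have := (tendsto_arctan_div_nhdsGT_of_neg (s := b - t) (by linarith)).sub
        (tendsto_arctan_div_nhdsGT_of_neg (s := a - t) (by linarith))
      rw [Set.indicator_of_notMem (fun h => absurd h.2 (by linarith))]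
      simpa using this

theorem integrable_div_sub {g : ℝ → ℂ} (hg : MemLp g 2 volume) {z : ℂ} (hz : z.im ≠ 0) :
    Integrable (fun t : ℝ => g t / ((t : ℂ) - z)) := by
  simp only [div_eq_mul_inv]
  exact hg.integrable_mul (memLp_inv_ofReal_sub hz)

/-- With z = x + iy, the Poisson kernel is (1/(t - z) - 1/(t - z̄))/(2i), a combination of two
Cauchy kernels. -/
theorem integral_mul_poisson_eq_zero {g : ℝ → ℂ} (hg : MemLp g 2 volume)
    (h0 : ∀ z : ℂ, z.im ≠ 0 → ∫ t : ℝ, g t / ((t : ℂ) - z) = 0) (x : ℝ) {y : ℝ} (hy : 0 < y) :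
    ∫ t : ℝ, g t * ((y / (y ^ 2 + (x - t) ^ 2) : ℝ) : ℂ) = 0 := by
  have hp : (⟨x, y⟩ : ℂ).im ≠ 0 := hy.ne'
  have hm : (⟨x, -y⟩ : ℂ).im ≠ 0 := by simpa using hy.ne'
  have h : ∫ t : ℝ, (2 * Complex.I)⁻¹ * (g t / ((t : ℂ) - ⟨x, y⟩) - g t / ((t : ℂ) - ⟨x, -y⟩)) = 0 := by
    rw [integral_const_mul, integral_sub (integrable_div_sub hg hp) (integrable_div_sub hg hm),
      h0 _ hp, h0 _ hm]
    simp
  rw [← h]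
  congr 1
  funext t
  have h1 := ofReal_sub_ne_zero hp t
  have h2 := ofReal_sub_ne_zero hm t
  have h3 : ((y : ℂ) ^ 2 + ((x : ℂ) - t) ^ 2) = ((t : ℂ) - ⟨x, y⟩) * ((t : ℂ) - ⟨x, -y⟩) := by
    apply Complex.ext <;> simp [pow_two] <;> ring
  have h4 : ((t : ℂ) - ⟨x, -y⟩) - ((t : ℂ) - ⟨x, y⟩) = 2 * Complex.I * y := by
    apply Complex.ext <;> simp ; ring
  push_cast
  have h5 : g t * ((t : ℂ) - ⟨x, -y⟩) - ((t : ℂ) - ⟨x, y⟩) * g t = 2 * Complex.I * (g t * y) := by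
    linear_combination g t * h4
  rw [h3, div_sub_div _ _ h1 h2, h5, mul_div_assoc (2 * Complex.I),
    inv_mul_cancel_left₀ (by simp), mul_div_assoc]

/-- Integrate the vanishing Poisson integral over x ∈ [a, b] and exchange the integrals. -/
theorem integral_mul_arctan_eq_zero {g : ℝ → ℂ} (hg : MemLp g 2 volume)
    (h0 : ∀ z : ℂ, z.im ≠ 0 → ∫ t : ℝ, g t / ((t : ℂ) - z) = 0) {a b y : ℝ} (hab : a ≤ b)
    (hy : 0 < y) :
    ∫ t : ℝ, g t * ((Real.arctan ((b - t) / y) - Real.arctan ((a - t) / y) : ℝ) : ℂ) = 0 := by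
  have hden : ∀ p : ℝ × ℝ, y ^ 2 + (p.1 - p.2) ^ 2 ≠ 0 := fun p => by positivity
  have hcont : Continuous fun p : ℝ × ℝ => ((y / (y ^ 2 + (p.1 - p.2) ^ 2) : ℝ) : ℂ) :=
    Complex.continuous_ofReal.comp (Continuous.div (by fun_prop) (by fun_prop) hden)
  have hint : Integrable (Function.uncurry fun (x t : ℝ) =>
      g t * ((y / (y ^ 2 + (x - t) ^ 2) : ℝ) : ℂ))
      ((volume.restrict (Set.Ioc a b)).prod volume) := by
    set M : ℝ := |a| + |b|
    -- The constant comes from comparing kernels with ε = y: 1 + t² = |t - i|² ≤ (1 + (M + y +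
    -- 1)/y)² |t - (x + iy)|².
    have hbd : Integrable (fun p : ℝ × ℝ => (y * (1 + (M + y + 1) / y) ^ 2) *
        (‖g p.2‖ * (1 + p.2 ^ 2)⁻¹)) ((volume.restrict (Set.Ioc a b)).prod volume) :=
      ((integrable_mul_inv_one_add_sq hg).comp_snd _).const_mul _
    refine hbd.mono' (hg.1.comp_snd.mul hcont.aestronglyMeasurable) ?_
    have hmem : ∀ᵐ p ∂((volume.restrict (Set.Ioc a b)).prod (volume : Measure ℝ)),
        p.1 ∈ Set.Ioc a b :=
      Measure.quasiMeasurePreserving_fst.ae (ae_restrict_mem measurableSet_Ioc)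
    filter_upwards [hmem] with p hp
    obtain ⟨x, t⟩ := p
    simp only [Function.uncurry] at hp ⊢
    have hx1 : |x| ≤ M := by
      rw [abs_le]
      constructor
      · linarith [neg_abs_le a, abs_nonneg b, hp.1]
      · linarith [le_abs_self b, abs_nonneg a, hp.2]
    have hz : (y : ℝ) ≤ ‖(t : ℂ) - ⟨x, y⟩‖ := by
      simpa [abs_of_pos hy] using abs_im_le_norm_ofReal_sub ⟨x, y⟩ t
    have h1 := norm_ofReal_sub_I_le hy hz
    have h2 : ‖(⟨x, y⟩ : ℂ) - Complex.I‖ ≤ M + y + 1 := by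
      refine (Complex.norm_le_abs_re_add_abs_im _).trans ?_
      have : |y - 1| ≤ y + 1 := by rw [abs_le]; constructor <;> linarith
      simp
      linarith
    have h3 : ‖(t : ℂ) - Complex.I‖ ≤ (1 + (M + y + 1) / y) * ‖(t : ℂ) - ⟨x, y⟩‖ := by
      refine h1.trans ?_
      gcongr
    have h4 : ‖(t : ℂ) - Complex.I‖ ^ 2 = 1 + t ^ 2 := by
      rw [Complex.sq_norm, Complex.normSq_apply]; simp; ring
    have h5 : ‖(t : ℂ) - ⟨x, y⟩‖ ^ 2 = y ^ 2 + (x - t) ^ 2 := by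
      rw [Complex.sq_norm, Complex.normSq_apply]; simp; ring
    have h6 : 1 + t ^ 2 ≤ (1 + (M + y + 1) / y) ^ 2 * (y ^ 2 + (x - t) ^ 2) := by
      rw [← h4, ← h5, ← mul_pow]
      gcongr
    have hd : 0 < y ^ 2 + (x - t) ^ 2 := by positivity
    rw [norm_mul, Complex.norm_real, Real.norm_of_nonneg (by positivity)]
    have h7 : y / (y ^ 2 + (x - t) ^ 2) ≤ y * (1 + (M + y + 1) / y) ^ 2 * (1 + t ^ 2)⁻¹ := by
      rw [← div_eq_mul_inv, div_le_div_iff₀ hd (by positivity)]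
      nlinarith
    calc _ ≤ ‖g t‖ * (y * (1 + (M + y + 1) / y) ^ 2 * (1 + t ^ 2)⁻¹) := by gcongr
      _ = _ := by ring
  have hswap := integral_integral_swap hint
  simp only [integral_mul_poisson_eq_zero hg h0 _ hy, integral_zero] at hswap
  rw [hswap]
  congr 1
  funext t
  rw [integral_const_mul, ← integral_poisson_eq_arctan, intervalIntegral.integral_of_le hab,
    integral_complex_ofReal]

/-- As y ↓ 0 the arctangent weight tends to π times the indicator of (a, b], except at the two
endpoints. -/
theorem intervalIntegral_eq_zero_of_cauchy {g : ℝ → ℂ} (hg : MemLp g 2 volume)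
    (h0 : ∀ z : ℂ, z.im ≠ 0 → ∫ t : ℝ, g t / ((t : ℂ) - z) = 0) {a b : ℝ} (hab : a < b) :
    ∫ t in a..b, g t = 0 := by
  have hlim : Tendsto (fun y : ℝ => ∫ t : ℝ,
      g t * ((Real.arctan ((b - t) / y) - Real.arctan ((a - t) / y) : ℝ) : ℂ)) (𝓝[>] 0)
      (𝓝 (∫ t : ℝ, g t * (((Set.Ioc a b).indicator (fun _ => Real.pi) t : ℝ) : ℂ))) := by
    refine tendsto_integral_filter_of_dominated_convergence
      (fun t => (Real.pi * (1 + (2 * (|a| + |b| + 1)) ^ 2) + 8 * (b - a)) *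
        (‖g t‖ * (1 + t ^ 2)⁻¹)) ?_ ?_ ((integrable_mul_inv_one_add_sq hg).const_mul _) ?_
    · refine Eventually.of_forall fun y => hg.1.mul ?_
      refine Continuous.aestronglyMeasurable (Complex.continuous_ofReal.comp ?_)
      exact (Real.continuous_arctan.comp (by fun_prop)).sub
        (Real.continuous_arctan.comp (by fun_prop))
    · filter_upwards [Ioc_mem_nhdsGT (zero_lt_one' ℝ)] with y hy
      refine ae_of_all _ fun t => ?_
      rw [norm_mul, Complex.norm_real, Real.norm_eq_abs]
      have := mul_le_mul_of_nonneg_left (abs_arctan_sub_arctan_le (t := t) hab.le hy.1 hy.2)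
        (norm_nonneg (g t))
      linarith
    · have ha : ∀ᵐ t : ℝ, t ≠ a := by simp [ae_iff]
      have hb : ∀ᵐ t : ℝ, t ≠ b := by simp [ae_iff]
      filter_upwards [ha, hb] with t hta htb
      exact ((Complex.continuous_ofReal.tendsto _).comp
        (tendsto_arctan_sub_arctan hab hta htb)).const_mul _
  have hzero := tendsto_nhds_unique_of_eventuallyEq hlim tendsto_const_nhds
    (eventually_mem_nhdsWithin.mono fun y hy => integral_mul_arctan_eq_zero hg h0 hab.le hy)
  have h1 : ∀ t, g t * (((Set.Ioc a b).indicator (fun _ => Real.pi) t : ℝ) : ℂ)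
      = (Set.Ioc a b).indicator (fun t => g t * (Real.pi : ℂ)) t := by
    intro t
    by_cases ht : t ∈ Set.Ioc a b <;> simp [ht]
  simp only [h1] at hzero
  rw [integral_indicator measurableSet_Ioc, integral_mul_const] at hzero
  rw [intervalIntegral.integral_of_le hab.le]
  simpa [Real.pi_ne_zero] using hzero

/-- A square integrable function whose Cauchy transform vanishes off the real line is zero. -/
theorem ae_eq_zero_of_cauchy_eq_zero {g : ℝ → ℂ} (hg : MemLp g 2 volume)
    (h0 : ∀ z : ℂ, z.im ≠ 0 → ∫ t : ℝ, g t / ((t : ℂ) - z) = 0) : g =ᵐ[volume] 0 := by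
  have hint : ∀ a b : ℝ, ∫ t in a..b, g t = 0 := by
    intro a b
    rcases lt_trichotomy a b with h | h | h
    · exact intervalIntegral_eq_zero_of_cauchy hg h0 h
    · simp [h]
    · rw [intervalIntegral.integral_symm, intervalIntegral_eq_zero_of_cauchy hg h0 h, neg_zero]
  -- By Lebesgue differentiation, g is a.e. the derivative of its primitive, which is identically
  -- zero.
  filter_upwards 
    [LocallyIntegrable.ae_hasDerivAt_integral (hg.locallyIntegrable (by norm_num))] with x hx
  have h := hx 0
  simp only [hint] at h
  exact h.unique (hasDerivAt_const x (0 : ℂ))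

/-! ### Cauchy kernels in L² and their traces -/

open Classical in
/-- The function `t ↦ 1 / (t - z)` as an element of `L²(ℝ)`, for nonreal `z`. -/
noncomputable def cauchyKer (z : ℂ) : L2R :=
  if hz : z.im ≠ 0 then (memLp_inv_ofReal_sub hz).toLp _ else 0

theorem coeFn_cauchyKer {z : ℂ} (hz : z.im ≠ 0) :
    cauchyKer z =ᵐ[volume] fun t : ℝ => ((t : ℂ) - z)⁻¹ := by
  rw [cauchyKer, dif_pos hz]
  exact MemLp.coeFn_toLp _

theorem norm_div_sub_le {z : ℂ} (hz : z.im ≠ 0) (w : ℂ) (t : ℝ) :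
    ‖w / ((t : ℂ) - z)‖ ≤ |z.im|⁻¹ * ‖w‖ := by
  rw [norm_div, div_eq_inv_mul]
  gcongr
  exact abs_im_le_norm_ofReal_sub z t

theorem memLp_div_sub {g : ℝ → ℂ} (hg : MemLp g 2 volume) {z : ℂ} (hz : z.im ≠ 0) :
    MemLp (fun t : ℝ => g t / ((t : ℂ) - z)) 2 volume :=
  hg.of_le_mul (aestronglyMeasurable_div_sub hg.1 z)
    (ae_of_all _ fun t => norm_div_sub_le hz (g t) t)

open Classical in
/-- Multiplication by `1 / (t - z)` on `L²(ℝ)`, for nonreal `z`. -/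
noncomputable def cauchyMul (z : ℂ) : L2R →L[ℂ] L2R :=
  if hz : z.im ≠ 0 then
    LinearMap.mkContinuous
      { toFun := fun g => (memLp_div_sub (Lp.memLp g) hz).toLp _
        map_add' := fun f g => by
          rw [← MemLp.toLp_add]
          refine MemLp.toLp_congr _ _ ?_
          filter_upwards [Lp.coeFn_add f g] with t ht
          simp only [ht, Pi.add_apply, add_div]
        map_smul' := fun a f => by
          rw [RingHom.id_apply, ← MemLp.toLp_const_smul]
          refine MemLp.toLp_congr _ _ ?_
          filter_upwards [Lp.coeFn_smul a f] with t ht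
          simp only [ht, Pi.smul_apply, smul_eq_mul, mul_div_assoc] }
      |z.im|⁻¹
      (fun g => by
        refine Lp.norm_le_mul_norm_of_ae_le_mul ?_
        filter_upwards [(memLp_div_sub (Lp.memLp g) hz).coeFn_toLp] with t ht
        simp only [LinearMap.coe_mk, AddHom.coe_mk, ht]
        exact norm_div_sub_le hz (g t) t)
  else 0

theorem coeFn_cauchyMul {z : ℂ} (hz : z.im ≠ 0) (g : L2R) :
    cauchyMul z g =ᵐ[volume] fun t : ℝ => g t / ((t : ℂ) - z) := by
  rw [cauchyMul, dif_pos hz]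
  exact MemLp.coeFn_toLp (memLp_div_sub (Lp.memLp g) hz)

theorem norm_cauchyMul_apply_le {z : ℂ} (hz : z.im ≠ 0) (g : L2R) :
    ‖cauchyMul z g‖ ≤ |z.im|⁻¹ * ‖g‖ := by
  refine Lp.norm_le_mul_norm_of_ae_le_mul ?_
  filter_upwards [coeFn_cauchyMul hz g] with t ht
  rw [ht]
  exact norm_div_sub_le hz (g t) t

theorem cauchyConj_eq_inner {z : ℂ} (hz : z.im ≠ 0) (φ : L2R) :
    cauchyConj φ z = inner ℂ φ (cauchyKer z) := by
  rw [cauchyConj, L2.inner_def]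
  refine integral_congr_ae ?_
  filter_upwards [coeFn_cauchyKer hz] with t ht
  rw [ht, RCLike.inner_apply, div_eq_mul_inv, mul_comm]

theorem perturbD_eq_inner {z : ℂ} (hz : z.im ≠ 0) (φ ψ : L2R) :
    perturbD φ ψ z = 1 + inner ℂ φ (cauchyMul z ψ) := by
  rw [perturbD, L2.inner_def]
  congr 1
  refine integral_congr_ae ?_
  filter_upwards [coeFn_cauchyMul hz ψ] with t ht
  rw [ht, RCLike.inner_apply]
  ring

theorem conj_im_ne_zero {z : ℂ} (hz : z.im ≠ 0) : ((starRingEnd ℂ) z).im ≠ 0 := by simpa using hz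

theorem inner_cauchyKer_conj {z : ℂ} (hz : z.im ≠ 0) (g : L2R) :
    inner ℂ (cauchyKer ((starRingEnd ℂ) z)) g = ∫ t : ℝ, g t / ((t : ℂ) - z) := by
  rw [L2.inner_def]
  refine integral_congr_ae ?_
  filter_upwards [coeFn_cauchyKer (conj_im_ne_zero hz)] with t ht
  rw [ht, RCLike.inner_apply, div_eq_mul_inv]
  simp

theorem cauchyKer_mem_maxDomain (z : ℂ) : cauchyKer z ∈ maxDomain := by
  by_cases hz : z.im ≠ 0
  · refine ⟨1, ((Lp.memLp (cauchyKer z)).const_mul z).ae_eq ?_⟩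
    filter_upwards [coeFn_cauchyKer hz] with t ht
    have := ofReal_sub_ne_zero hz t
    rw [ht]
    field_simp
    ring
  · rw [cauchyKer, dif_neg hz]
    exact zero_mem _

theorem memLp_mul_cauchyMul {z : ℂ} (hz : z.im ≠ 0) (g : L2R) :
    MemLp (fun x : ℝ => (x : ℂ) * cauchyMul z g x - 0) 2 volume := by
  refine ((Lp.memLp g).add ((Lp.memLp (cauchyMul z g)).const_mul z)).ae_eq ?_
  filter_upwards [coeFn_cauchyMul hz g] with t ht
  have := ofReal_sub_ne_zero hz t
  rw [Pi.add_apply, ht]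
  field_simp
  ring

theorem cauchyMul_mem_maxDomain (z : ℂ) (g : L2R) : cauchyMul z g ∈ maxDomain := by
  by_cases hz : z.im ≠ 0
  · exact ⟨0, memLp_mul_cauchyMul hz g⟩
  · rw [cauchyMul, dif_neg hz]
    exact zero_mem _

theorem Gamma2_cauchyKer {z : ℂ} (hz : z.im ≠ 0) :
    Gamma2 ⟨cauchyKer z, cauchyKer_mem_maxDomain z⟩ = 1 := by
  refine traceConst_unique _ _ _ (traceConst_spec _)
    (((Lp.memLp (cauchyKer z)).const_mul z).ae_eq ?_)
  filter_upwards [coeFn_cauchyKer hz] with t ht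
  have := ofReal_sub_ne_zero hz t
  simp only [ht]
  field_simp
  ring

theorem Gamma2_cauchyMul {z : ℂ} (hz : z.im ≠ 0) (g : L2R) :
    Gamma2 ⟨cauchyMul z g, cauchyMul_mem_maxDomain z g⟩ = 0 :=
  traceConst_unique _ _ _ (traceConst_spec _) (memLp_mul_cauchyMul hz g)

theorem Gamma1_cauchyMul {z : ℂ} (hz : z.im ≠ 0) (g : L2R) :
    Gamma1 ⟨cauchyMul z g, cauchyMul_mem_maxDomain z g⟩
      = inner ℂ (cauchyKer ((starRingEnd ℂ) z)) g := by
  refine tendsto_nhds_unique (traceInt_spec _) ?_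
  rw [inner_cauchyKer_conj hz, ← integral_congr_ae (coeFn_cauchyMul hz g)]
  refine intervalIntegral_tendsto_integral ?_ tendsto_neg_atTop_atBot tendsto_id
  exact (integrable_div_sub (Lp.memLp g) hz).congr (coeFn_cauchyMul hz g).symm

/-- The trace `Γ₁` of `t ↦ 1 / (t - z)`. -/
noncomputable def cauchyTrace (z : ℂ) : ℂ := Gamma1 ⟨cauchyKer z, cauchyKer_mem_maxDomain z⟩

/-- Every solution of (Ã* - z)f = g has this shape; its traces can then be read off. -/
theorem Gamma_of_eq {z : ℂ} (hz : z.im ≠ 0) {f : maxDomain} {h : L2R} {c : ℂ}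
    (hf : (f : L2R) = cauchyMul z h + c • cauchyKer z) :
    Gamma1 f = inner ℂ (cauchyKer ((starRingEnd ℂ) z)) h + c * cauchyTrace z ∧ Gamma2 f = c := by
  have : f = ⟨cauchyMul z h, cauchyMul_mem_maxDomain z h⟩
      + c • ⟨cauchyKer z, cauchyKer_mem_maxDomain z⟩ := Subtype.ext hf
  rw [this, map_add, map_add, map_smul, map_smul, Gamma1_cauchyMul hz, Gamma2_cauchyMul hz,
    Gamma2_cauchyKer hz]
  simp [cauchyTrace]

/-! ### The resolvent equation as a 2 × 2 linear system -/

theorem friedrichsMax_apply (φ ψ : L2R) (f : maxDomain) :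
    friedrichsMax φ ψ f = (traceConst_spec f).toLp _ + inner ℂ φ (f : L2R) • ψ := rfl

/-- Divide the equation by t - z. The unknown f then occurs on the right only through the two
scalars ⟨f, φ⟩ and c_f. -/
theorem friedrichsMax_sub_smul_eq_iff {z : ℂ} (hz : z.im ≠ 0) (φ ψ : L2R) (f : maxDomain)
    (g : L2R) :
    friedrichsMax φ ψ f - z • (f : L2R) = g ↔
      (f : L2R) = cauchyMul z (g - inner ℂ φ (f : L2R) • ψ) + Gamma2 f • cauchyKer z := by
  set α := inner ℂ φ (f : L2R)
  have hl : (friedrichsMax φ ψ f - z • (f : L2R) : L2R) =ᵐ[volume]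
      fun t : ℝ => ((t : ℂ) * (f : L2R) t - Gamma2 f) + α * ψ t - z * (f : L2R) t := by
    rw [friedrichsMax_apply]
    filter_upwards [Lp.coeFn_sub ((traceConst_spec f).toLp _ + α • ψ) (z • (f : L2R)),
      Lp.coeFn_add ((traceConst_spec f).toLp _) (α • ψ), Lp.coeFn_smul α ψ,
      Lp.coeFn_smul z (f : L2R), (traceConst_spec f).coeFn_toLp] with t h1 h2 h3 h4 h5
    rw [h1, Pi.sub_apply, h2, Pi.add_apply, h3, h4, h5]
    rfl
  have hr : (cauchyMul z (g - α • ψ) + Gamma2 f • cauchyKer z : L2R) =ᵐ[volume]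
      fun t : ℝ => (g t - α * ψ t + Gamma2 f) / ((t : ℂ) - z) := by
    filter_upwards [Lp.coeFn_add (cauchyMul z (g - α • ψ)) (Gamma2 f • cauchyKer z),
      coeFn_cauchyMul hz (g - α • ψ), Lp.coeFn_sub g (α • ψ), Lp.coeFn_smul α ψ,
      Lp.coeFn_smul (Gamma2 f) (cauchyKer z), coeFn_cauchyKer hz] with t h1 h2 h3 h4 h5 h6
    rw [h1, Pi.add_apply, h2, h3, Pi.sub_apply, h4, h5, Pi.smul_apply, Pi.smul_apply, h6]
    simp only [smul_eq_mul]
    ring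
  constructor
  · intro h
    rw [h] at hl
    refine Lp.ext ?_
    filter_upwards [hl, hr] with t h1 h2
    have := ofReal_sub_ne_zero hz t
    rw [h2, h1]
    field_simp
    ring
  · intro h
    rw [← h] at hr
    refine Lp.ext ?_
    filter_upwards [hl, hr] with t h1 h2
    have := ofReal_sub_ne_zero hz t
    rw [h1]
    have h3 : (f : L2R) t * ((t : ℂ) - z) = g t - α * ψ t + Gamma2 f := by
      rw [h2]; field_simp
    linear_combination h3

theorem exists_friedrichsExt_eq_iff {φ ψ : L2R} {B z : ℂ} {f g : L2R} :
    (∃ hf : f ∈ (friedrichsExt φ ψ B).domain, friedrichsExt φ ψ B ⟨f, hf⟩ - z • f = g) ↔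
      ∃ hf : f ∈ maxDomain, friedrichsMax φ ψ ⟨f, hf⟩ - z • f = g ∧
        Gamma1 ⟨f, hf⟩ = B * Gamma2 ⟨f, hf⟩ := by
  have happ : ∀ (h1 : f ∈ (friedrichsExt φ ψ B).domain) (h2 : f ∈ maxDomain),
      friedrichsExt φ ψ B ⟨f, h1⟩ = friedrichsMax φ ψ ⟨f, h2⟩ :=
    fun h1 h2 => LinearPMap.domRestrict_apply rfl
  constructor
  · rintro ⟨hf, h⟩
    obtain ⟨⟨x, hx, hxf⟩, hm⟩ := id hf
    refine ⟨hm, ?_, ?_⟩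
    · rw [← happ hf hm, h]
    · have : x = ⟨f, hm⟩ := Subtype.ext hxf
      subst this
      simpa [sub_eq_zero] using hx
  · rintro ⟨hm, h, hG⟩
    have hf : f ∈ (friedrichsExt φ ψ B).domain :=
      ⟨⟨⟨f, hm⟩, by simpa [sub_eq_zero] using hG, rfl⟩, hm⟩
    exact ⟨hf, by rw [happ hf hm, h]⟩

/-- The determinant whose nonreal zeros are the nonreal eigenvalues of `A_B`. -/
noncomputable def charDet (φ ψ : L2R) (B z : ℂ) : ℂ :=
  perturbD φ ψ z * (B - cauchyTrace z)
    + cauchyConj φ z * inner ℂ (cauchyKer ((starRingEnd ℂ) z)) ψ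

/-- Let a = ⟨f, φ⟩ and d = c_f. Pairing the divided equation with φ gives D a - p d = G g, and the
boundary condition gives q a + (B - s) d = E g. The determinant is `charDet`, and Cramer's rule
yields a and d as the bounded functionals `al` and `c` of g. -/
theorem mem_resolventSetOf_of_charDet_ne_zero {φ ψ : L2R} {B z : ℂ} (hz : z.im ≠ 0)
    (hdet : charDet φ ψ B z ≠ 0) : z ∈ resolventSetOf (friedrichsExt φ ψ B) := by
  set G : L2R →L[ℂ] ℂ := (innerSL ℂ φ).comp (cauchyMul z)
  set E : L2R →L[ℂ] ℂ := innerSL ℂ (cauchyKer ((starRingEnd ℂ) z))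
  set D := perturbD φ ψ z with hD
  set s := cauchyTrace z with hs
  set p := cauchyConj φ z with hp
  set q := inner ℂ (cauchyKer ((starRingEnd ℂ) z)) ψ with hq
  set Δ := charDet φ ψ B z with hΔ
  have hdef : Δ = D * (B - s) + p * q := rfl
  set al : L2R →L[ℂ] ℂ := Δ⁻¹ • ((B - s) • G + p • E) with hal
  set c : L2R →L[ℂ] ℂ := Δ⁻¹ • (D • E - q • G) with hc
  have hG : ∀ g, G g = inner ℂ φ (cauchyMul z g) := fun _ => rfl
  have hE : ∀ g, E g = inner ℂ (cauchyKer ((starRingEnd ℂ) z)) g := fun _ => rfl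
  have hal' : ∀ g, Δ * al g = (B - s) * G g + p * E g := fun g => by
    simp [hal, ← mul_add, mul_inv_cancel_left₀ hdet]
  have hc' : ∀ g, Δ * c g = D * E g - q * G g := fun g => by
    simp only [hc, smul_apply, sub_apply, smul_eq_mul,
      mul_inv_cancel_left₀ hdet]
  have h1 : ∀ g, D * al g - p * c g = G g := fun g => by
    apply mul_left_cancel₀ hdet
    linear_combination D * hal' g - p * hc' g - G g * hdef
  have h2 : ∀ g, q * al g + (B - s) * c g = E g := fun g => by
    apply mul_left_cancel₀ hdet
    linear_combination q * hal' g + (B - s) * hc' g - E g * hdef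
  have hDψ : inner ℂ φ (cauchyMul z ψ) = D - 1 := by
    rw [hD, perturbD_eq_inner hz]; ring
  have hpk : inner ℂ φ (cauchyKer z) = p := (cauchyConj_eq_inner hz φ).symm
  refine ⟨(cauchyMul z).comp (ContinuousLinearMap.id ℂ L2R - al.smulRight ψ)
    + c.smulRight (cauchyKer z), fun f g => ?_⟩
  have hR : ((cauchyMul z).comp (ContinuousLinearMap.id ℂ L2R - al.smulRight ψ)
    + c.smulRight (cauchyKer z)) g = cauchyMul z (g - al g • ψ) + c g • cauchyKer z := rfl
  rw [hR, exists_friedrichsExt_eq_iff]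
  constructor
  · rintro rfl
    set f := cauchyMul z (g - al g • ψ) + c g • cauchyKer z with hf
    have hm : f ∈ maxDomain := add_mem (cauchyMul_mem_maxDomain _ _)
      (Submodule.smul_mem _ _ (cauchyKer_mem_maxDomain _))
    obtain ⟨hg1, hg2⟩ := Gamma_of_eq hz (f := ⟨f, hm⟩) hf
    have hin : inner ℂ φ f = al g := by
      rw [hf, map_sub, map_smul, inner_add_right, inner_sub_right, inner_smul_right,
        inner_smul_right, hDψ, hpk, ← hG]
      linear_combination -h1 g
    refine ⟨hm, ?_, ?_⟩
    · refine (friedrichsMax_sub_smul_eq_iff hz φ ψ ⟨f, hm⟩ g).mpr ?_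
      rw [hg2]
      simp only [hin]
      exact hf
    · rw [hg1, hg2, inner_sub_right, inner_smul_right, ← hE, ← hq, ← hs]
      linear_combination -h2 g
  · rintro ⟨hm, h, hB⟩
    replace h := (friedrichsMax_sub_smul_eq_iff hz φ ψ ⟨f, hm⟩ g).mp h
    obtain ⟨hg1, -⟩ := Gamma_of_eq hz h
    set a := inner ℂ φ f with ha
    set d := Gamma2 ⟨f, hm⟩ with hd
    simp only at h
    -- Uniqueness: the scalars of any solution satisfy the same nonsingular system.
    have e1 : D * a - p * d = G g := by
      have := congrArg (fun v : L2R => (inner ℂ φ v : ℂ)) h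
      simp only [map_sub, map_smul, inner_add_right, inner_sub_right, inner_smul_right, hDψ, hpk,
        ← hG, ← ha] at this
      linear_combination this
    have e2 : q * a + (B - s) * d = E g := by
      rw [hg1, inner_sub_right, inner_smul_right, ← hE, ← hq, ← hs] at hB
      linear_combination -hB
    have e3 : al g = a := by
      apply mul_left_cancel₀ hdet
      linear_combination hal' g - (B - s) * e1 - p * e2 - a * hdef
    have e4 : c g = d := by
      apply mul_left_cancel₀ hdet
      linear_combination hc' g - D * e2 + q * e1 - d * hdef
    rw [e3, e4]
    exact h.symm

/-! ### Asymptotics along the imaginary axis -/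

theorem integral_univ_inv_sq_add_sq {y : ℝ} (hy : 0 < y) :
    ∫ t : ℝ, (y ^ 2 + t ^ 2)⁻¹ = Real.pi / y := by
  have hint : Integrable fun t : ℝ => (y ^ 2 + t ^ 2)⁻¹ := by
    have h := (integrable_inv_one_add_sq.comp_div hy.ne').const_mul (y ^ 2)⁻¹
    refine h.congr (ae_of_all _ fun t => ?_)
    field_simp
  refine tendsto_nhds_unique
    (intervalIntegral_tendsto_integral hint tendsto_neg_atTop_atBot tendsto_id) ?_
  simp only [integral_inv_sq_add_sq hy.ne']
  have h1 : Tendsto (fun R : ℝ => Real.arctan (R / y)) atTop (𝓝 (Real.pi / 2)) :=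
    (tendsto_nhds_of_tendsto_nhdsWithin Real.tendsto_arctan_atTop).comp
      (tendsto_id.atTop_div_const hy)
  convert (h1.add h1).const_mul y⁻¹ using 2
  · simp [neg_div, Real.arctan_neg]
  · ring

theorem norm_sq_cauchyKer_imaginary {y : ℝ} (hy : y ≠ 0) :
    ‖cauchyKer ⟨0, y⟩‖ ^ 2 = Real.pi / |y| := by
  have hz : (⟨0, y⟩ : ℂ).im ≠ 0 := hy
  have h1 : ((‖cauchyKer ⟨0, y⟩‖ ^ 2 : ℝ) : ℂ)
      = ((∫ t : ℝ, (|y| ^ 2 + t ^ 2)⁻¹ : ℝ) : ℂ) := by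
    rw [← integral_complex_ofReal, Complex.ofReal_pow]
    refine (inner_self_eq_norm_sq_to_K (𝕜 := ℂ) (cauchyKer ⟨0, y⟩)).symm.trans ?_
    rw [L2.inner_def]
    refine integral_congr_ae ?_
    filter_upwards [coeFn_cauchyKer hz] with t ht
    rw [ht, RCLike.inner_apply, RCLike.mul_conj, norm_inv, sq_abs]
    have : ‖(t : ℂ) - ⟨0, y⟩‖ ^ 2 = y ^ 2 + t ^ 2 := by
      rw [Complex.sq_norm, Complex.normSq_apply]; simp; ring
    rw [← this]
    push_cast
    simp
  rw [Complex.ofReal_injective h1, integral_univ_inv_sq_add_sq (abs_pos.mpr hy)]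

section Limits

variable {ι : Type*} {l : Filter ι} {y : ι → ℝ}

theorem eventually_ne_zero_of_abs_atTop (hy : Tendsto (fun i => |y i|) l atTop) :
    ∀ᶠ i in l, y i ≠ 0 :=
  (hy.eventually_gt_atTop 0).mono fun _ hi => abs_pos.mp hi

theorem tendsto_cauchyKer (hy : Tendsto (fun i => |y i|) l atTop) :
    Tendsto (fun i => cauchyKer ⟨0, y i⟩) l (𝓝 0) := by
  rw [tendsto_zero_iff_norm_tendsto_zero]
  have h1 : Tendsto (fun i => Real.sqrt (Real.pi / |y i|)) l (𝓝 0) := by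
    rw [← Real.sqrt_zero]
    exact (Real.continuous_sqrt.tendsto 0).comp (hy.const_div_atTop Real.pi)
  refine h1.congr' ?_
  filter_upwards [eventually_ne_zero_of_abs_atTop hy] with i hi
  rw [← norm_sq_cauchyKer_imaginary hi, Real.sqrt_sq (norm_nonneg _)]

theorem tendsto_cauchyMul (hy : Tendsto (fun i => |y i|) l atTop) (g : L2R) :
    Tendsto (fun i => cauchyMul ⟨0, y i⟩ g) l (𝓝 0) := by
  rw [tendsto_zero_iff_norm_tendsto_zero]
  have h1 : Tendsto (fun i => |y i|⁻¹ * ‖g‖) l (𝓝 0) := by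
    simpa using (tendsto_inv_atTop_zero.comp hy).mul_const ‖g‖
  refine squeeze_zero' (Eventually.of_forall fun i => norm_nonneg _) ?_ h1
  filter_upwards [eventually_ne_zero_of_abs_atTop hy] with i hi
  exact norm_cauchyMul_apply_le hi g

theorem tendsto_cauchyConj (hy : Tendsto (fun i => |y i|) l atTop) (φ : L2R) :
    Tendsto (fun i => cauchyConj φ ⟨0, y i⟩) l (𝓝 0) := by
  have h := (innerSL ℂ φ).continuous.tendsto 0 |>.comp (tendsto_cauchyKer hy)
  rw [map_zero] at h
  refine h.congr' ?_
  filter_upwards [eventually_ne_zero_of_abs_atTop hy] with i hi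
  exact (cauchyConj_eq_inner hi φ).symm

theorem tendsto_perturbD (hy : Tendsto (fun i => |y i|) l atTop) (φ ψ : L2R) :
    Tendsto (fun i => perturbD φ ψ ⟨0, y i⟩) l (𝓝 1) := by
  have h := ((innerSL ℂ φ).continuous.tendsto 0 |>.comp (tendsto_cauchyMul hy ψ)).const_add 1
  rw [map_zero, add_zero] at h
  refine h.congr' ?_
  filter_upwards [eventually_ne_zero_of_abs_atTop hy] with i hi
  exact (perturbD_eq_inner hi φ ψ).symm

theorem tendsto_inner_cauchyKer_conj (hy : Tendsto (fun i => |y i|) l atTop) (ψ : L2R) :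
    Tendsto (fun i => inner ℂ (cauchyKer ((starRingEnd ℂ) ⟨0, y i⟩)) ψ) l (𝓝 0) := by
  have hy' : Tendsto (fun i => |-y i|) l atTop := by simpa using hy
  have h := (tendsto_cauchyKer hy').inner (𝕜 := ℂ) (tendsto_const_nhds (x := ψ))
  rwa [inner_zero_left] at h

end Limits

/-- The kernel is not integrable, but folding t ↦ -t turns it into the Poisson kernel: 1/(t - iy) +
1/(-t - iy) = 2iy/(y² + t²). The traces on the two half-axes are therefore iπ and -iπ. -/
theorem cauchyTrace_eq_of_tendsto_arctan {y : ℝ} (hy : y ≠ 0) {a : ℝ}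
    (ha : Tendsto (fun R : ℝ => Real.arctan (R / y)) atTop (𝓝 a)) :
    cauchyTrace ⟨0, y⟩ = 2 * Complex.I * a := by
  have hz : (⟨0, y⟩ : ℂ).im ≠ 0 := hy
  refine tendsto_nhds_unique (traceInt_spec _)
    (Tendsto.congr (fun R => ?_)
      (((Complex.continuous_ofReal.tendsto a).comp ha).const_mul (2 * Complex.I)))
  have hcont : Continuous fun t : ℝ => ((t : ℂ) - ⟨0, y⟩)⁻¹ :=
    Continuous.inv₀ (by fun_prop) (ofReal_sub_ne_zero hz)
  have hcont' : Continuous fun t : ℝ => (((-t : ℝ) : ℂ) - ⟨0, y⟩)⁻¹ :=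
    hcont.comp continuous_neg
  have h1 : ∫ t in (-R)..R, (cauchyKer ⟨0, y⟩ : ℝ → ℂ) t
      = ∫ t in (-R)..R, ((t : ℂ) - ⟨0, y⟩)⁻¹ := by
    refine intervalIntegral.integral_congr_ae ?_
    filter_upwards [coeFn_cauchyKer hz] with t ht _ using ht
  have h2 : ∫ t in (-R)..R, (((-t : ℝ) : ℂ) - ⟨0, y⟩)⁻¹
      = ∫ t in (-R)..R, ((t : ℂ) - ⟨0, y⟩)⁻¹ := by
    simpa using intervalIntegral.integral_comp_neg (a := -R) (b := R)
      (fun t : ℝ => ((t : ℂ) - ⟨0, y⟩)⁻¹)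
  have h3 : ∫ t in (-R)..R, (((t : ℂ) - ⟨0, y⟩)⁻¹ + (((-t : ℝ) : ℂ) - ⟨0, y⟩)⁻¹)
      = ∫ t in (-R)..R, (2 * Complex.I) * ((y / (y ^ 2 + t ^ 2) : ℝ) : ℂ) := by
    congr 1
    funext t
    have e1 := ofReal_sub_ne_zero hz t
    have e2 := ofReal_sub_ne_zero hz (-t)
    have e3 : ((y : ℂ) ^ 2 + (t : ℂ) ^ 2) = -(((t : ℂ) - ⟨0, y⟩) * (((-t : ℝ) : ℂ) - ⟨0, y⟩)) := by
      apply Complex.ext <;> simp [pow_two] <;> ring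
    have e4 : (((-t : ℝ) : ℂ) - ⟨0, y⟩) + ((t : ℂ) - ⟨0, y⟩) = -(2 * Complex.I * y) := by
      apply Complex.ext <;> simp ; ring
    rw [inv_add_inv e1 e2, add_comm, e4, Complex.ofReal_div, Complex.ofReal_add,
      Complex.ofReal_pow, Complex.ofReal_pow, e3, div_neg, neg_div, mul_neg, mul_div_assoc]
  rw [intervalIntegral.integral_add (hcont.intervalIntegrable _ _)
    (hcont'.intervalIntegrable _ _), h2, intervalIntegral.integral_const_mul,
    intervalIntegral.integral_ofReal, integral_div_sq_add_sq, neg_div, Real.arctan_neg] at h3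
  change 2 * Complex.I * (Real.arctan (R / y) : ℂ) = ∫ t in (-R)..R, (cauchyKer ⟨0, y⟩ : ℝ → ℂ) t
  rw [h1]
  simp only [Complex.ofReal_sub, Complex.ofReal_neg] at h3
  linear_combination -(1 / 2 : ℂ) * h3

theorem cauchyTrace_of_pos {y : ℝ} (hy : 0 < y) :
    cauchyTrace ⟨0, y⟩ = 2 * Complex.I * ((Real.pi / 2 : ℝ) : ℂ) :=
  cauchyTrace_eq_of_tendsto_arctan hy.ne'
    ((tendsto_nhds_of_tendsto_nhdsWithin Real.tendsto_arctan_atTop).comp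
      (tendsto_id.atTop_div_const hy))

theorem cauchyTrace_of_neg {y : ℝ} (hy : y < 0) :
    cauchyTrace ⟨0, y⟩ = 2 * Complex.I * ((-(Real.pi / 2) : ℝ) : ℂ) :=
  cauchyTrace_eq_of_tendsto_arctan hy.ne
    ((tendsto_nhds_of_tendsto_nhdsWithin Real.tendsto_arctan_atBot).comp
      (tendsto_id.atTop_div_const_of_neg hy))

/-- For every `B` there is a half of the imaginary axis along which `Γ₁ - B Γ₂` does not degenerate
on `1 / (t - z)`. -/
theorem exists_tendsto_cauchyTrace (B : ℂ) :
    ∃ (y : ℕ → ℝ) (s : ℂ), Tendsto (fun n => |y n|) atTop atTop ∧ s ≠ B ∧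
      Tendsto (fun n => cauchyTrace ⟨0, y n⟩) atTop (𝓝 s) := by
  have hN : Tendsto (fun n : ℕ => (n : ℝ)) atTop atTop := tendsto_natCast_atTop_atTop
  -- The limits iπ and -iπ differ, so B can equal at most one of them; the other half-axis is used.
  by_cases hB : 2 * Complex.I * ((Real.pi / 2 : ℝ) : ℂ) = B
  · refine ⟨fun n => -n, 2 * Complex.I * ((-(Real.pi / 2) : ℝ) : ℂ), by simpa using hN, ?_, ?_⟩
    · intro h
      have := congrArg Complex.im (hB.trans h.symm)
      simp at this
      linarith [Real.pi_pos]
    · refine tendsto_const_nhds.congr' ?_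
      filter_upwards [eventually_gt_atTop 0] with n hn
      exact (cauchyTrace_of_neg (by simpa using hn)).symm
  · refine ⟨fun n => n, _, by simpa using hN, hB, ?_⟩
    refine tendsto_const_nhds.congr' ?_
    filter_upwards [eventually_gt_atTop 0] with n hn
    exact (cauchyTrace_of_pos (by simpa using hn)).symm

/-! ### Defect solutions and the detectable subspace -/

/-- The solution `(1 - M(z) ψ) / (t - z)` of `(Ã* - z) u = 0`, where `M` is the quotient of the
Cauchy transform of `conj φ` by `D`. -/
noncomputable def defectSol (φ ψ : L2R) (z : ℂ) : L2R :=
  cauchyKer z - (cauchyConj φ z / perturbD φ ψ z) • cauchyMul z ψ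

theorem defectSol_eq (φ ψ : L2R) (z : ℂ) :
    defectSol φ ψ z
      = cauchyMul z (0 - (cauchyConj φ z / perturbD φ ψ z) • ψ) + (1 : ℂ) • cauchyKer z := by
  rw [defectSol, zero_sub, map_neg, map_smul, one_smul]
  abel

theorem defectSol_mem_maxDomain (φ ψ : L2R) (z : ℂ) : defectSol φ ψ z ∈ maxDomain :=
  sub_mem (cauchyKer_mem_maxDomain z) (Submodule.smul_mem _ _ (cauchyMul_mem_maxDomain z ψ))

/-- Used with χ = φ, where it collapses to M(z), and with χ = φ', where it links M to the second
model. -/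
theorem inner_left_defectSol {φ ψ : L2R} {z : ℂ} (hz : z.im ≠ 0) (χ : L2R) :
    inner ℂ χ (defectSol φ ψ z)
      = cauchyConj χ z - cauchyConj φ z / perturbD φ ψ z * (perturbD χ ψ z - 1) := by
  rw [defectSol, inner_sub_right, inner_smul_right, cauchyConj_eq_inner hz χ,
    perturbD_eq_inner hz χ]
  ring

theorem inner_defectSol {φ ψ : L2R} {z : ℂ} (hz : z.im ≠ 0) (hD : perturbD φ ψ z ≠ 0) :
    inner ℂ φ (defectSol φ ψ z) = cauchyConj φ z / perturbD φ ψ z := by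
  rw [inner_left_defectSol hz]
  field_simp
  ring

theorem Gamma_defectSol {φ ψ : L2R} {z : ℂ} (hz : z.im ≠ 0) :
    Gamma1 ⟨defectSol φ ψ z, defectSol_mem_maxDomain φ ψ z⟩
        = cauchyTrace z - cauchyConj φ z / perturbD φ ψ z *
          inner ℂ (cauchyKer ((starRingEnd ℂ) z)) ψ ∧
      Gamma2 ⟨defectSol φ ψ z, defectSol_mem_maxDomain φ ψ z⟩ = 1 := by
  obtain ⟨h1, h2⟩ := Gamma_of_eq hz
    (f := ⟨defectSol φ ψ z, defectSol_mem_maxDomain φ ψ z⟩) (defectSol_eq φ ψ z)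
  refine ⟨?_, h2⟩
  rw [h1, inner_sub_right, inner_zero_right, inner_smul_right]
  ring

theorem friedrichsMax_defectSol {φ ψ : L2R} {z : ℂ} (hz : z.im ≠ 0) (hD : perturbD φ ψ z ≠ 0) :
    friedrichsMax φ ψ ⟨defectSol φ ψ z, defectSol_mem_maxDomain φ ψ z⟩
      - z • defectSol φ ψ z = 0 := by
  refine (friedrichsMax_sub_smul_eq_iff hz φ ψ
    ⟨defectSol φ ψ z, defectSol_mem_maxDomain φ ψ z⟩ 0).mpr ?_
  rw [(Gamma_defectSol hz).2]
  simp only [inner_defectSol hz hD]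
  exact defectSol_eq φ ψ z

/-- The boundary value `(Γ₁ - B Γ₂) u` of the solution `defectSol`. -/
noncomputable def defectTrace (φ ψ : L2R) (B z : ℂ) : ℂ :=
  cauchyTrace z - cauchyConj φ z / perturbD φ ψ z * inner ℂ (cauchyKer ((starRingEnd ℂ) z)) ψ - B

theorem charDet_eq_neg_mul_defectTrace {φ ψ : L2R} {z : ℂ} (hD : perturbD φ ψ z ≠ 0) (B : ℂ) :
    charDet φ ψ B z = -(perturbD φ ψ z * defectTrace φ ψ B z) := by
  rw [charDet, defectTrace]
  field_simp
  ring

theorem mem_resolventSetOf_of_defectTrace_ne_zero {φ ψ : L2R} {B z : ℂ} (hz : z.im ≠ 0)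
    (hD : perturbD φ ψ z ≠ 0) (hd : defectTrace φ ψ B z ≠ 0) :
    z ∈ resolventSetOf (friedrichsExt φ ψ B) :=
  mem_resolventSetOf_of_charDet_ne_zero hz <| by
    rw [charDet_eq_neg_mul_defectTrace hD]
    exact neg_ne_zero.mpr (mul_ne_zero hD hd)

theorem isResolventOf_resolventOf {T : L2R →ₗ.[ℂ] L2R} {z : ℂ} (hz : z ∈ resolventSetOf T) :
    IsResolventOf T z (resolventOf T z) := by
  have h : ∃ R : L2R →L[ℂ] L2R, IsResolventOf T z R := hz
  rw [resolventOf, dif_pos h]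
  exact Classical.choose_spec h

theorem friedrichsMax_map_sub_smul (φ ψ : L2R) (a : ℂ) (f g : maxDomain) :
    friedrichsMax φ ψ (a • f - g) = a • friedrichsMax φ ψ f - friedrichsMax φ ψ g := by
  exact (map_sub (friedrichsMax φ ψ).toFun (a • f) g).trans
    (congrArg (· - friedrichsMax φ ψ g) (map_smul (friedrichsMax φ ψ).toFun a f))

/-- The resolvent of `A_B` maps a solution at `μ` to the difference quotient of solutions. -/
theorem smul_resolventOf_solution {φ ψ : L2R} {B μ z : ℂ} (hz : z.im ≠ 0)
    (hD : perturbD φ ψ z ≠ 0) (hd : defectTrace φ ψ B z ≠ 0) {u : L2R} (hu : u ∈ maxDomain)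
    (hsol : friedrichsMax φ ψ ⟨u, hu⟩ - μ • u = 0) :
    (z - μ) • resolventOf (friedrichsExt φ ψ B) z u
      = ((Gamma1 ⟨u, hu⟩ - B * Gamma2 ⟨u, hu⟩) / defectTrace φ ψ B z) • defectSol φ ψ z - u := by
  have hres := isResolventOf_resolventOf (mem_resolventSetOf_of_defectTrace_ne_zero hz hD hd)
  set w := Gamma1 ⟨u, hu⟩ - B * Gamma2 ⟨u, hu⟩ with hw
  -- This scalar makes a u_z - u satisfy the boundary condition, while (Ã* - z)(a u_z - u) = (z -
  -- μ)u.
  set a := w / defectTrace φ ψ B z with ha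
  have had : a * defectTrace φ ψ B z = w := div_mul_cancel₀ _ hd
  have hv := defectSol_mem_maxDomain φ ψ z
  have hmem : a • defectSol φ ψ z - u ∈ maxDomain :=
    sub_mem (Submodule.smul_mem _ _ hv) hu
  have hsub : (⟨a • defectSol φ ψ z - u, hmem⟩ : maxDomain)
      = a • ⟨defectSol φ ψ z, hv⟩ - ⟨u, hu⟩ := rfl
  rw [← map_smul, hres, exists_friedrichsExt_eq_iff]
  refine ⟨hmem, ?_, ?_⟩
  · have h1 := friedrichsMax_map_sub_smul φ ψ a ⟨defectSol φ ψ z, hv⟩ ⟨u, hu⟩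
    have h2 : friedrichsMax φ ψ ⟨a • defectSol φ ψ z - u, hmem⟩
      = a • friedrichsMax φ ψ ⟨defectSol φ ψ z, hv⟩ - friedrichsMax φ ψ ⟨u, hu⟩ := h1
    have h3 := sub_eq_zero.mp (friedrichsMax_defectSol hz hD)
    have h4 := sub_eq_zero.mp hsol
    rw [h2, h3, h4]
    module
  · rw [hsub, map_sub, map_smul, map_sub, map_smul, (Gamma_defectSol hz).1, (Gamma_defectSol hz).2]
    simp only [smul_eq_mul]
    rw [defectTrace] at had
    linear_combination had + hw

/-- In the difference-quotient formula u_z → 0, while its boundary value tends to s - B ≠ 0. Only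
the term -u survives. -/
theorem tendsto_smul_resolventOf_solution {ι : Type*} {l : Filter ι} {y : ι → ℝ}
    (hy : Tendsto (fun i => |y i|) l atTop) {φ ψ : L2R} {B μ s : ℂ} (hs : s ≠ B)
    (hys : Tendsto (fun i => cauchyTrace ⟨0, y i⟩) l (𝓝 s)) {u : L2R} (hu : u ∈ maxDomain)
    (hsol : friedrichsMax φ ψ ⟨u, hu⟩ - μ • u = 0) :
    (∀ᶠ i in l, (⟨0, y i⟩ : ℂ) ∈ resolventSetOf (friedrichsExt φ ψ B)) ∧
      Tendsto (fun i => ((⟨0, y i⟩ : ℂ) - μ) • resolventOf (friedrichsExt φ ψ B) ⟨0, y i⟩ u) l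
        (𝓝 (-u)) := by
  have hp := tendsto_cauchyConj hy φ
  have hD := tendsto_perturbD hy φ ψ
  have hM := hp.div hD one_ne_zero
  have hd : Tendsto (fun i => defectTrace φ ψ B ⟨0, y i⟩) l (𝓝 (s - B)) := by
    simpa [defectTrace] using
      (hys.sub (hM.mul (tendsto_inner_cauchyKer_conj hy ψ))).sub_const B
  have hu0 : Tendsto (fun i => defectSol φ ψ ⟨0, y i⟩) l (𝓝 0) := by
    simpa [defectSol] using (tendsto_cauchyKer hy).sub (hM.smul (tendsto_cauchyMul hy ψ))
  have hsB : s - B ≠ 0 := sub_ne_zero.mpr hs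
  have hev := (eventually_ne_zero_of_abs_atTop hy).and
    ((hD.eventually_ne one_ne_zero).and (hd.eventually_ne hsB))
  constructor
  · exact hev.mono fun i hi => mem_resolventSetOf_of_defectTrace_ne_zero hi.1 hi.2.1 hi.2.2
  · have hlim := (((tendsto_const_nhds (x := Gamma1 ⟨u, hu⟩ - B * Gamma2 ⟨u, hu⟩)).div hd
      hsB).smul hu0).sub_const u
    rw [smul_zero, zero_sub] at hlim
    refine hlim.congr' ?_
    filter_upwards [hev] with i hi
    exact (smul_resolventOf_solution hi.1 hi.2.1 hi.2.2 hu hsol).symm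

theorem defectSol_mem_detectableSubspace {φ ψ : L2R} {μ : ℂ} (hμ : μ.im ≠ 0)
    (hD : perturbD φ ψ μ ≠ 0) : defectSol φ ψ μ ∈ detectableSubspace φ ψ := by
  obtain ⟨B, hB⟩ : ∃ B, defectTrace φ ψ B μ ≠ 0 :=
    -- The boundary value has the form X - B; the choice B = X - 1 makes it 1, so that μ ∈ ρ(A_B)
    -- can itself serve as the base point.
    ⟨defectTrace φ ψ 1 μ, fun h => one_ne_zero (α := ℂ) (by
      simp only [defectTrace] at h
      linear_combination h)⟩
  have hu := defectSol_mem_maxDomain φ ψ μ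
  have hsol := friedrichsMax_defectSol hμ hD
  obtain ⟨y, s, hy, hs, hys⟩ := exists_tendsto_cauchyTrace B
  obtain ⟨hev, hlim⟩ := tendsto_smul_resolventOf_solution hy hs hys hu hsol
  rw [← neg_mem_iff, detectableSubspace, ← SetLike.mem_coe, Submodule.topologicalClosure_coe]
  refine mem_closure_of_tendsto hlim (hev.mono fun n hn => ?_)
  refine Submodule.smul_mem _ _ ?_
  have hmem : resolventOf (friedrichsExt φ ψ B) ⟨0, y n⟩ (defectSol φ ψ μ)
      ∈ detectableSpan φ ψ B μ :=
    Submodule.subset_span ⟨_, hn, _, ⟨_, hu, hsol, rfl⟩, rfl⟩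
  have hle : detectableSpan φ ψ B μ ≤ ⨆ (B : ℂ) (μ₀ : ℂ)
      (_ : μ₀ ∈ resolventSetOf (friedrichsExt φ ψ B)), detectableSpan φ ψ B μ₀ :=
    le_iSup_of_le B (le_iSup_of_le μ (le_iSup_of_le
      (mem_resolventSetOf_of_defectTrace_ne_zero hμ hD hB) le_rfl))
  exact hle hmem

/-! ### Consequences of equal restricted resolvents -/

/-- The resolvents agree on u_μ because it is detectable, which equates the rank-one terms on the
resolvent vectors; the limit z → ∞ transfers the equality to u_μ itself. -/
theorem inner_smul_eq_of_sameRestrictedResolvent {φ ψ φ' ψ' : L2R} {B B' : ℂ}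
    (h : SameRestrictedResolvent φ ψ B φ' ψ' B') {μ : ℂ} (hμ : μ.im ≠ 0)
    (hD : perturbD φ ψ μ ≠ 0) :
    (inner ℂ φ (defectSol φ ψ μ) : ℂ) • ψ = (inner ℂ φ' (defectSol φ ψ μ) : ℂ) • ψ' := by
  have hu := defectSol_mem_maxDomain φ ψ μ
  have hsol := friedrichsMax_defectSol hμ hD
  obtain ⟨y, s, hy, hs, hys⟩ := exists_tendsto_cauchyTrace B
  obtain ⟨hev, hlim⟩ := tendsto_smul_resolventOf_solution hy hs hys hu hsol
  have hl : ∀ χ η : L2R, Tendsto (fun n => (inner ℂ χ (((⟨0, y n⟩ : ℂ) - μ) •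
      resolventOf (friedrichsExt φ ψ B) ⟨0, y n⟩ (defectSol φ ψ μ)) : ℂ) • η) atTop
      (𝓝 ((inner ℂ χ (-defectSol φ ψ μ) : ℂ) • η)) := fun χ η =>
    ((tendsto_const_nhds (x := χ)).inner hlim).smul_const η
  have hlim' := tendsto_nhds_unique_of_eventuallyEq (hl φ ψ) (hl φ' ψ') ?_
  · simpa [inner_neg_right] using hlim'
  · filter_upwards [hev, eventually_ne_zero_of_abs_atTop hy] with n hn hyn
    obtain ⟨h1, h2⟩ := h.2 ⟨0, y n⟩ hyn
    have hR := h2 hn _ (defectSol_mem_detectableSubspace hμ hD)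
    obtain ⟨hf, e, -⟩ := exists_friedrichsExt_eq_iff.mp
      ((isResolventOf_resolventOf hn _ (defectSol φ ψ μ)).mp rfl)
    obtain ⟨hf', e', -⟩ := exists_friedrichsExt_eq_iff.mp
      ((isResolventOf_resolventOf (h1.mp hn) _ (defectSol φ ψ μ)).mp hR.symm)
    -- The part x v - c_v depends on v alone, not on the model, so it cancels together with z v.
    have e2 := e.trans e'.symm
    have e3 : inner ℂ φ (resolventOf (friedrichsExt φ ψ B) ⟨0, y n⟩ (defectSol φ ψ μ)) • ψ
        = inner ℂ φ' (resolventOf (friedrichsExt φ ψ B) ⟨0, y n⟩ (defectSol φ ψ μ)) • ψ' :=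
      add_left_cancel (sub_left_injective e2)
    rw [inner_smul_right, inner_smul_right, mul_smul, mul_smul, e3]

/-! ### The case of full detectable subspace -/

theorem perturbD_ne_zero_of_lt {φ ψ : L2R} {z : ℂ} (h : ‖φ‖ * ‖ψ‖ < |z.im|) :
    perturbD φ ψ z ≠ 0 := by
  have hpos : 0 < |z.im| := lt_of_le_of_lt (by positivity) h
  have hz : z.im ≠ 0 := abs_pos.mp hpos
  rw [perturbD_eq_inner hz]
  intro h0
  have h1 : inner ℂ φ (cauchyMul z ψ) = (-1 : ℂ) := by linear_combination h0
  have h2 := norm_inner_le_norm (𝕜 := ℂ) φ (cauchyMul z ψ)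
  rw [h1, norm_neg, norm_one] at h2
  have h3 := norm_cauchyMul_apply_le hz ψ
  have h4 : ‖φ‖ * ‖cauchyMul z ψ‖ ≤ ‖φ‖ * (|z.im|⁻¹ * ‖ψ‖) := by gcongr
  have h5 : ‖φ‖ * (|z.im|⁻¹ * ‖ψ‖) < 1 := by
    rw [show ‖φ‖ * (|z.im|⁻¹ * ‖ψ‖) = ‖φ‖ * ‖ψ‖ / |z.im| by ring, div_lt_one hpos]
    exact h
  linarith

theorem integrable_div_sub_I (g : L2R) :
    Integrable (fun t : ℝ => g t / ((t : ℂ) - Complex.I)) :=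
  integrable_div_sub (Lp.memLp g) (by simp)

/-- If the Cauchy transform of `g` vanishes far from the real line, then `g = 0`. -/
theorem eq_zero_of_cauchy_eq_zero_of_lt {g : L2R} {N : ℝ}
    (h : ∀ z : ℂ, N < |z.im| → ∫ t : ℝ, g t / ((t : ℂ) - z) = 0) : g = 0 := by
  have hN : 0 < |N| + 1 := by positivity
  have hNN : N < |N| + 1 := (le_abs_self N).trans_lt (lt_add_one _)
  -- The domain of analyticity is disconnected, so the identity theorem is applied in each
  -- half-plane, from a base point with |Im z| = |N| + 1 > N.
  have hup : ∀ z : ℂ, 0 < z.im → ∫ t : ℝ, g t / ((t : ℂ) - z) = 0 := by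
    have han := analyticOnNhd_integral_div_sub
      (isOpen_lt continuous_const Complex.continuous_im : IsOpen {z : ℂ | 0 < z.im})
      (integrable_div_sub_I g) (ae_of_all _ fun t ht => by simp at ht)
    refine han.eqOn_zero_of_preconnected_of_eventuallyEq_zero
      (convex_halfSpace_im_gt 0).isPreconnected (z₀ := ⟨0, |N| + 1⟩) hN ?_
    filter_upwards [(isOpen_lt continuous_const Complex.continuous_im).mem_nhds
      (show N < (⟨0, |N| + 1⟩ : ℂ).im from hNN)] with z hz
    exact h z (lt_of_lt_of_le hz (le_abs_self _))
  have hlow : ∀ z : ℂ, z.im < 0 → ∫ t : ℝ, g t / ((t : ℂ) - z) = 0 := by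
    have han := analyticOnNhd_integral_div_sub
      (isOpen_lt Complex.continuous_im continuous_const : IsOpen {z : ℂ | z.im < 0})
      (integrable_div_sub_I g) (ae_of_all _ fun t ht => by simp at ht)
    refine han.eqOn_zero_of_preconnected_of_eventuallyEq_zero
      (convex_halfSpace_im_lt 0).isPreconnected (z₀ := ⟨0, -(|N| + 1)⟩) (neg_neg_of_pos hN) ?_
    filter_upwards [(isOpen_lt Complex.continuous_im continuous_const).mem_nhds
      (show (⟨0, -(|N| + 1)⟩ : ℂ).im < -N from neg_lt_neg hNN)] with z hz
    exact h z (lt_of_lt_of_le (lt_neg_of_lt_neg hz) (neg_le_abs _))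
  refine (Lp.eq_zero_iff_ae_eq_zero).mpr (ae_eq_zero_of_cauchy_eq_zero (Lp.memLp g) fun z hz => ?_)
  exact hz.lt_or_gt.elim (hlow z) (hup z)

/-- Here u_z reduces to the Cauchy kernel. A vector g orthogonal to all detectable vectors has a
Cauchy transform vanishing wherever |Im z| > ‖φ‖‖ψ‖, a region free of zeros of D, and so g = 0. -/
theorem detectableSubspace_eq_top {φ ψ : L2R}
    (h : ∀ z : ℂ, z.im ≠ 0 → perturbD φ ψ z ≠ 0 →
      (cauchyConj φ z / perturbD φ ψ z) • ψ = 0) : detectableSubspace φ ψ = ⊤ := by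
  rw [detectableSubspace, Submodule.topologicalClosure_eq_top_iff, ← Submodule.orthogonal_closure,
    ← detectableSubspace, Submodule.eq_bot_iff]
  intro g hg
  refine eq_zero_of_cauchy_eq_zero_of_lt (N := ‖φ‖ * ‖ψ‖) fun z hz => ?_
  have hpos : 0 < |z.im| := lt_of_le_of_lt (by positivity) hz
  have hz0 : z.im ≠ 0 := abs_pos.mp hpos
  have hc := conj_im_ne_zero hz0
  -- The conjugate point appears because the inner product is conjugate linear in its first slot:
  -- pairing the kernel at z̄ with g gives ∫ g/(t - z).
  have hD : perturbD φ ψ ((starRingEnd ℂ) z) ≠ 0 := perturbD_ne_zero_of_lt (by simpa using hz)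
  have hmem := defectSol_mem_detectableSubspace hc hD
  rw [defectSol, ← map_smul, h _ hc hD, map_zero, sub_zero] at hmem
  rw [← inner_cauchyKer_conj hz0]
  exact (Submodule.mem_orthogonal _ _).mp hg _ hmem

/-- Expanding ⟨u_μ, φ'⟩ gives an equation linear in M(μ), in which M(μ) has the coefficient 1 + c∫ψ
conj(φ')/(x - μ) dx, the function D of (φ', cψ). -/
theorem cauchyConj_smul_div {φ ψ φ' : L2R} {c μ : ℂ} (hμ : μ.im ≠ 0)
    (hD' : perturbD φ' (c • ψ) μ ≠ 0)
    (h : cauchyConj φ μ / perturbD φ ψ μ = c * inner ℂ φ' (defectSol φ ψ μ)) :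
    cauchyConj φ μ / perturbD φ ψ μ = c * (cauchyConj φ' μ / perturbD φ' (c • ψ) μ) := by
  have hsm : perturbD φ' (c • ψ) μ = 1 + c * (perturbD φ' ψ μ - 1) := by
    rw [perturbD_eq_inner hμ, perturbD_eq_inner hμ, map_smul, inner_smul_right]
    ring
  rw [inner_left_defectSol hμ] at h
  rw [← mul_div_assoc, eq_div_iff hD', hsm]
  linear_combination h

/-! ### The main theorem -/

theorem mainTheorem3 (φ ψ : L2R) (B : ℂ) :
    ((∃ K : Set ℝ, IsCompact K ∧ ∀ᵐ x : ℝ, x ∉ K → φ x = 0) → QuotientContinues φ ψ) ∧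
    ((∃ a b : ℝ, a < b ∧ ∀ᵐ x : ℝ, x ∈ Set.Ioo a b → φ x = 0) → QuotientContinues φ ψ) ∧
    (QuotientContinues φ ψ →
      detectableSubspace φ ψ = ⊤ ∨
      ∀ (φ' ψ' : L2R) (B' : ℂ), SameRestrictedResolvent φ ψ B φ' ψ' B' →
        ∃ c : ℂ, c ≠ 0 ∧ ψ' = c • ψ ∧
          ∀ μ : ℂ, μ.im ≠ 0 → perturbD φ ψ μ ≠ 0 → perturbD φ' ψ' μ ≠ 0 →
            cauchyConj φ μ / perturbD φ ψ μ =
              c * (cauchyConj φ' μ / perturbD φ' ψ' μ)) := by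
  refine ⟨fun ⟨K, hK, h⟩ => quotientContinues_of_isCompact ψ hK h,
    fun ⟨a, b, hab, h⟩ => quotientContinues_of_ae_eq_zero_Ioo ψ hab h, fun _ => ?_⟩
  -- The dichotomy is whether Mψ vanishes at every admissible point.
  by_cases htop : ∀ z : ℂ, z.im ≠ 0 → perturbD φ ψ z ≠ 0 →
      (cauchyConj φ z / perturbD φ ψ z) • ψ = 0
  · exact Or.inl (detectableSubspace_eq_top htop)
  refine Or.inr fun φ' ψ' B' hsame => ?_
  push Not at htop
  obtain ⟨z, hz, hDz, hne⟩ := htop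
  have key := inner_smul_eq_of_sameRestrictedResolvent hsame hz hDz
  rw [inner_defectSol hz hDz] at key
  set a := cauchyConj φ z / perturbD φ ψ z with ha
  set b : ℂ := inner ℂ φ' (defectSol φ ψ z) with hb
  have ha0 : a ≠ 0 := fun h => hne (by rw [h, zero_smul])
  have hψ : ψ ≠ 0 := fun h => hne (by rw [h, smul_zero])
  have hb0 : b ≠ 0 := fun h => hne (by rw [key, h, zero_smul])
  -- One point with aψ = bψ' ≠ 0 fixes the constant a/b; the relation at any other μ is then
  -- compared along the nonzero vector ψ.
  have hψ' : ψ' = (a / b) • ψ := by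
    rw [div_eq_inv_mul, mul_smul, key, inv_smul_smul₀ hb0]
  refine ⟨a / b, div_ne_zero ha0 hb0, hψ', fun μ hμ hD hD' => ?_⟩
  have hk := inner_smul_eq_of_sameRestrictedResolvent hsame hμ hD
  rw [inner_defectSol hμ hD, hψ', smul_smul] at hk
  rw [hψ'] at hD' ⊢
  refine cauchyConj_smul_div hμ hD' ?_
  rw [smul_left_injective ℂ hψ hk, mul_comm]
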